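/- Let $A$ and $B$ be simplicial sets. A map of simplicial sets $(p,q)\colon X\to A\times B$ is called a *bifibration* if 1. $(p,q)$ is an inner fibration; 2. for every $n\ge 1$ and every commutative square with left side $\Lambda^n_0\hookrightarrow\Delta^n$, right side $(p,q)\colon X\to A\times B$ and bottom map $v\colon\Delta^n\to A\times B$ such that $\pi_B v$ restricted to $\Delta^{\{0,1\}}$ is a degenerate edge of $B$, a diagonal filler $\Delta^n\to X$ exists; 3. for every $n\ge 1$ and every commutative square with left side $\Lambda^n_n\hookrightarrow\Delta^n$, right side $(p,q)\colon X\to A\times B$ and bottom map $v\colon\Delta^n\to A\times B$ such that $\pi_A v$ restricted to $\Delta^{\{n-1,n\}}$ is a degenerate edge of $A$, a diagonal filler $\Delta^n\to X$ exists. For simplicial sets $M, W$ over $A\times B$, let $\mathrm{map}_{A\times B}(M,W)$ be the simplicial mapping space, i.e. the fiber of $W^M\to (A\times B)^M$ over the vertex given by the structure map of $M$. A map $f\colon X\to Y$ of simplicial sets over $A\times B$ is a *bivariant equivalence* if for every bifibration $W\to A\times B$ the induced map $$\mathrm{map}_{A\times B}(Y,W)\to \mathrm{map}_{A\times B}(X,W)$$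 is a homotopy equivalence between Kan complexes. It is a *pointwise weak homotopy equivalence* if for every vertex $a$ of $A$ and every vertex $b$ of $B$ the induced map of fibers $X_{(a,b)}\to Y_{(a,b)}$ is a weak homotopy equivalence of simplicial sets (that is, it induces a bijection $\pi_0(K^{Y_{(a,b)}})\to\pi_0(K^{X_{(a,b)}})$ for every Kan complex $K$). **Theorem.** Let $X\to A\times B$ and $Y\to A\times B$ be bifibrations. Then a map $f\colon X\to Y$ of simplicial sets over $A\times B$ is a bivariant equivalence if and only if it is a pointwise weak homotopy equivalence. -/

import Mathlib

open CategoryTheory Limits MonoidalCategory CartesianMonoidalCategory Simplicial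

universe u

noncomputable section

namespace Bivariant

/-- The fiber of a map `p : X ⟶ S` of simplicial sets over a vertex `s : Δ[0] ⟶ S`. -/
abbrev fiber {X S : SSet.{u}} (p : X ⟶ S) (s : Δ[0] ⟶ S) : SSet.{u} :=
  pullback p s

/-- The map between fibers over a vertex `s` induced by a map over `S`. -/
def fiberMap {X Y S : SSet.{u}} {p : X ⟶ S} {q : Y ⟶ S} (f : X ⟶ Y) (w : f ≫ q = p)
    (s : Δ[0] ⟶ S) : fiber p s ⟶ fiber q s :=
  pullback.lift (pullback.fst p s ≫ f) (pullback.snd p s)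
    (by rw [Category.assoc, w, pullback.condition])

/-- The vertex `(a, b)` of `A × B` as a map from `Δ[0]`. -/
def vertexPair {A B : SSet.{u}} (a : A _⦋0⦌) (b : B _⦋0⦌) : Δ[0] ⟶ A ⊗ B :=
  lift (SSet.yonedaEquiv.symm a) (SSet.yonedaEquiv.symm b)

/-- The vertex of the simplicial set `S ^ X` corresponding to a map `p : X ⟶ S`. -/
def homVertex {X S : SSet.{u}} (p : X ⟶ S) : Δ[0] ⟶ (ihom X).obj S :=
  MonoidalClosed.curry (fst X Δ[0] ≫ p)

/-- The simplicial mapping space `map_S(X, Y)` of objects `p : X ⟶ S` and `q : Y ⟶ S` over `S`: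
the pullback of `Y ^ X ⟶ S ^ X` along the vertex of `S ^ X` given by `p`. -/
abbrev mapOver {X Y S : SSet.{u}} (p : X ⟶ S) (q : Y ⟶ S) : SSet.{u} :=
  fiber ((ihom X).map q) (homVertex p)

lemma homVertex_pre {X Y S : SSet.{u}} (f : X ⟶ Y) (q : Y ⟶ S) :
    homVertex q ≫ (MonoidalClosed.pre f).app S = homVertex (f ≫ q) := by
  simp only [homVertex, MonoidalClosed.curry_pre_app]
  congr 1

/-- The map `map_S(Y, Z) ⟶ map_S(X, Z)` given by precomposition with a map `f : X ⟶ Y` over `S`. -/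
def mapOverPre {X Y Z S : SSet.{u}} {p : X ⟶ S} {q : Y ⟶ S} (f : X ⟶ Y) (w : f ≫ q = p)
    (r : Z ⟶ S) : mapOver q r ⟶ mapOver p r :=
  pullback.lift
    (pullback.fst ((ihom Y).map r) (homVertex q) ≫ (MonoidalClosed.pre f).app Z)
    (pullback.snd ((ihom Y).map r) (homVertex q))
    (by
      rw [Category.assoc, ← (MonoidalClosed.pre f).naturality r, pullback.condition_assoc,
        homVertex_pre, w])

/-- Bifibrations `(p, q) : X ⟶ A × B` of simplicial sets. -/
structure IsBifibration {A B X : SSet.{u}} (p : X ⟶ A ⊗ B) : Prop where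
  inner : SSet.InnerFibration p
  left_horn : ∀ (n : ℕ) (u : (Λ[n + 1, 0] : SSet.{u}) ⟶ X) (v : Δ[n + 1] ⟶ A ⊗ B)
    (sq : CommSq u Λ[n + 1, 0].ι p v),
    (v ≫ snd A B).app _ (SSet.stdSimplex.edge (n + 1) 0 1 (Fin.zero_le _)) ∈ B.degenerate 1 →
    sq.HasLift
  right_horn : ∀ (n : ℕ) (u : (Λ[n + 1, Fin.last (n + 1)] : SSet.{u}) ⟶ X)
    (v : Δ[n + 1] ⟶ A ⊗ B) (sq : CommSq u Λ[n + 1, Fin.last (n + 1)].ι p v),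
    (v ≫ fst A B).app _
      (SSet.stdSimplex.edge (n + 1) (Fin.last n).castSucc (Fin.last (n + 1)) (Fin.le_last _)) ∈
        A.degenerate 1 →
    sq.HasLift

/-- Simplicial homotopy equivalences. -/
def IsHomotopyEquivalence {X Y : SSet.{u}} (f : X ⟶ Y) : Prop :=
  ∃ g : Y ⟶ X, Nonempty (SSet.Homotopy (f ≫ g) (𝟙 X)) ∧ Nonempty (SSet.Homotopy (g ≫ f) (𝟙 Y))

/-- Weak homotopy equivalences of simplicial sets: maps `f : X ⟶ Y` such that
`π₀ (K ^ Y) ⟶ π₀ (K ^ X)` is bijective for every Kan complex `K`. -/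
def IsWeakHomotopyEquivalence {X Y : SSet.{u}} (f : X ⟶ Y) : Prop :=
  ∀ K : SSet.{u}, SSet.KanComplex K →
    Function.Bijective (SSet.mapπ₀ ((MonoidalClosed.pre f).app K))

/-- Bivariant equivalences: a map `f : X ⟶ Y` over `A × B` such that `map(Y, W) ⟶ map(X, W)` is
a homotopy equivalence between Kan complexes for every bifibration `W ⟶ A × B`. -/
def IsBivariantEquivalence {A B X Y : SSet.{u}} {p : X ⟶ A ⊗ B} {q : Y ⟶ A ⊗ B}
    (f : X ⟶ Y) (w : f ≫ q = p) : Prop :=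
  ∀ (W : SSet.{u}) (r : W ⟶ A ⊗ B), IsBifibration r →
    SSet.KanComplex (mapOver q r) ∧ SSet.KanComplex (mapOver p r) ∧
      IsHomotopyEquivalence (mapOverPre f w r)

/-- Pointwise weak homotopy equivalences: for all vertices `a` of `A` and `b` of `B`, the map
induced on the fibers over `(a, b)` is a weak homotopy equivalence. -/
def IsPointwiseWeakHomotopyEquivalence {A B X Y : SSet.{u}} {p : X ⟶ A ⊗ B} {q : Y ⟶ A ⊗ B}
    (f : X ⟶ Y) (w : f ≫ q = p) : Prop :=
  ∀ (a : A _⦋0⦌) (b : B _⦋0⦌),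
    IsWeakHomotopyEquivalence (fiberMap f w (vertexPair a b))

end Bivariant

end

/-! Everything rests on one lifting property, `PrismLifts`. A bifibration lifts the inclusion of
`{k} × M ∪ Δ[1] × N` in `Δ[1] × M` over any cylinder in `A × B` whose edges over the relevant end
vertices are degenerate in `B` (for `k = 0`) or in `A` (for `k = 1`). The prism `Δ[1] × Δ[n]` is
built by horns that are inner, or outer with exactly such a distinguished edge. Over a point both
values of `k` are unconditional, so fibers behave as Kan complexes and mapping spaces over `A × B`
are Kan.

Pointwise implies bivariant: factor `f` as `j : X ⟶ P` followed by `g : P ⟶ Y`, where `P` is the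
mapping path space over `A × B`. Then `X` is a deformation retract of `P` over the base, and `g`
inherits prism lifting (`PathSpace.prismLifts_g`). On each fiber `g` is a weak equivalence, hence
lifts against boundary inclusions (`hasLiftingProperty_of_isWeakHomotopyEquivalence`). An arbitrary
simplex of `Y` is transported into a fiber by contracting its `A`-coordinate to the last vertex and
then its `B`-coordinate to the first (`hasLiftingProperty_boundary`). So `g` is a trivial fibration.
A section of it yields an inverse of `f` up to homotopy over `A × B`, which acts on all mapping
spaces.

Bivariant implies pointwise: as in the Yoneda lemma, testing on `W = X` and `W = Y` produces `g : Y
⟶ X` with `f ≫ g` homotopic over the base to the identity and `g ≫ f` in the component of the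
identity in `mapOver q q`. Both relations restrict to fibers. -/

noncomputable section

namespace Bivariant

open HomotopicalAlgebra

/-! ### Lifting along cell complexes, and the prisms `Δ[1] ⊗ Δ[n]`. -/

section Cells

/-- A morphism `f : X ⟶ Y` with the structure of a relative cell complex lifts against `p` over
`v : Y ⟶ S` as soon as every cell does. -/
theorem hasLift_of_cells {C : Type*} [Category C] {J : Type*} [LinearOrder J] [OrderBot J]
    [SuccOrder J] [WellFoundedLT J] {α : J → Type*} {A B : (j : J) → α j → C}
    {basicCell : (j : J) → (i : α j) → A j i ⟶ B j i} {X Y E S : C} {f : X ⟶ Y}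
    (c : RelativeCellComplex basicCell f) (p : E ⟶ S) (v : Y ⟶ S)
    (h : ∀ γ : c.Cells, HasLiftingPropertyFixedBot (basicCell γ.j γ.i) p (γ.ι ≫ v)) :
    HasLiftingPropertyFixedBot f p v := by
  intro u sq
  have hw : c.isoBot.hom ≫ f = c.incl.app ⊥ := (Iso.inv_comp_eq _).1 c.fac |>.symm
  have sq₀ : CommSq (c.isoBot.hom ≫ u) ((Cocone.mk Y c.incl).ι.app ⊥) p v := ⟨by
    have := sq.w
    rw [Category.assoc, this, reassoc_of% hw]⟩
  have key : sq₀.HasLift := HasLiftingProperty.transfiniteComposition.hasLift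
    (c := Cocone.mk Y c.incl) (hc := c.isColimit) (hF := fun j hj t sq' ↦ by
      let a := c.attachCells j hj
      have hι (i : a.ι) : RelativeCellComplex.Cells.ι ⟨j, hj, i⟩ =
          a.cofan₂.inj i ≫ a.g₂ ≫ c.incl.app (Order.succ j) := Category.assoc _ _ _
      have hsq (i : a.ι) : CommSq (a.cofan₁.inj i ≫ a.g₁ ≫ t) (basicCell j (a.π i)) p
          (RelativeCellComplex.Cells.ι ⟨j, hj, i⟩ ≫ v) := ⟨by
        have h1 := a.cofan₁.inj i ≫= a.isPushout.w =≫ (c.incl.app (Order.succ j) ≫ v)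
        have h2 := sq'.w
        dsimp at h2
        simp only [Category.assoc] at h1 ⊢
        rw [h2, h1, a.hm_assoc]
        rw [hι]
        simp only [Category.assoc]⟩
      have hl (i : a.ι) : (hsq i).HasLift := h ⟨j, hj, i⟩ _ _
      let l : a.cofan₂.pt ⟶ E := Cofan.IsColimit.desc a.isColimit₂ (fun i ↦ (hsq i).lift)
      have hinj (i : a.ι) : a.cofan₂.inj i ≫ l = (hsq i).lift :=
        Cofan.IsColimit.fac a.isColimit₂ _ i
      refine ⟨⟨{ l := a.isPushout.desc t l ?_, fac_left := a.isPushout.inl_desc _ _ _,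
                 fac_right := ?_ }⟩⟩
      · apply Cofan.IsColimit.hom_ext a.isColimit₁
        intro i
        rw [a.hm_assoc, hinj, CommSq.fac_left]
      · apply a.isPushout.hom_ext
        · rw [IsPushout.inl_desc_assoc]
          exact sq'.w
        · rw [IsPushout.inr_desc_assoc]
          apply Cofan.IsColimit.hom_ext a.isColimit₂
          intro i
          rw [reassoc_of% (hinj i), CommSq.fac_right]
          rw [hι]
          simp only [Category.assoc]) sq₀
  refine ⟨⟨{ l := key.exists_lift.some.l, fac_left := ?_, fac_right := ?_ }⟩⟩
  · have := key.exists_lift.some.fac_left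
    dsimp at this
    rw [← cancel_epi c.isoBot.hom, reassoc_of% hw, this]
  · exact key.exists_lift.some.fac_right

/-- Lifting along the inclusion of a subcomplex with a regular pairing, over a fixed base map. -/
theorem hasLift_of_pairing {Z X S : SSet.{u}} {A : Z.Subcomplex} (P : A.Pairing) [P.IsRegular]
    (p : X ⟶ S) (v : Z ⟶ S)
    (h : ∀ (d : ℕ) (x : Z _⦋d + 1⦌) (i : Fin (d + 2)), x ∈ Z.nonDegenerate (d + 1) →
      Z.δ i x ∉ A.obj _ →
      HasLiftingPropertyFixedBot Λ[d + 1, i].ι p (SSet.yonedaEquiv.symm x ≫ v)) :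
    HasLiftingPropertyFixedBot A.ι p v := by
  refine hasLift_of_cells P.rankFunction.relativeCellComplex p v (fun γ ↦ ?_)
  let c : P.rankFunction.Cell γ.j := γ.k
  have h1 : γ.ι = c.map := by
    exact congrArg (· ≫ (P.rankFunction.filtration (γ.j + 1)).ι) (c.ι_b)
  rw [h1]
  refine h c.dim _ c.index ?_ ?_
  · exact ((P.p c.s).1.cast (P.isUniquelyCodimOneFace c.s).dim_eq).nonDegenerate
  · have hδ := (P.isUniquelyCodimOneFace c.s).δ_index rfl
    intro hm
    refine (c.s.1.cast rfl).notMem ?_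
    rw [← hδ]
    exact hm

/-- Every left outer horn whose initial edge is mapped into `D` lifts against `p`. -/
def LeftHornLifts {X S : SSet.{u}} (D : Set (S _⦋1⦌)) (p : X ⟶ S) : Prop :=
  ∀ (n : ℕ) (v : Δ[n + 1] ⟶ S),
    v.app _ (SSet.stdSimplex.edge (n + 1) 0 1 (Fin.zero_le _)) ∈ D →
      HasLiftingPropertyFixedBot Λ[n + 1, 0].ι p v

/-- Every right outer horn whose final edge is mapped into `D` lifts against `p`. -/
def RightHornLifts {X S : SSet.{u}} (D : Set (S _⦋1⦌)) (p : X ⟶ S) : Prop :=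
  ∀ (n : ℕ) (v : Δ[n + 1] ⟶ S),
    v.app _ (SSet.stdSimplex.edge (n + 1) (Fin.last n).castSucc (Fin.last (n + 1))
      (Fin.le_last _)) ∈ D →
      HasLiftingPropertyFixedBot Λ[n + 1, Fin.last (n + 1)].ι p v

/-- The edge `Δ[1] × {m}` of the cylinder `Δ[1] ⊗ M`. -/
def edgeAt {M : SSet.{u}} (m : M _⦋0⦌) : (Δ[1] ⊗ M : SSet.{u}) _⦋1⦌ :=
  ⟨SSet.stdSimplex.edge 1 0 1 (Fin.zero_le _), M.σ 0 m⟩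

lemma fin_two_eq_of_lt {a b : Fin 2} (h : a < b) : a = 0 ∧ b = 1 := by
  revert a b
  decide

lemma notMem_unionProd_horn_boundary {k : Fin 2} {n d : ℕ} {x : (Δ[1] ⊗ Δ[n] : SSet.{u}) _⦋d⦌}
    (h : x ∉ (SSet.Subcomplex.unionProd Λ[1, k] ∂Δ[n]).obj _) :
    (∀ b, ∃ a, (SSet.prodStdSimplex.objEquiv x a).2 = b) ∧
      ∃ a, (SSet.prodStdSimplex.objEquiv x a).1 ≠ k := by
  have h' := mt (SSet.Subcomplex.mem_unionProd_iff _ _ x).2 h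
  rw [not_or, SSet.mem_boundary_iff_notMem_range, SSet.mem_horn_iff_notMem_range] at h'
  obtain ⟨h2, h1⟩ := h'
  push Not at h1 h2
  have hk : ∃ j : Fin 2, j ≠ k := exists_ne k
  obtain ⟨j, hj⟩ := hk
  obtain ⟨a, ha⟩ := h1 j hj
  exact ⟨h2, a, fun h ↦ hj (ha.symm.trans h)⟩

/-- The regular pairing attaches the missing simplices of the prism along horns. The filled face is
not in the subcomplex, so it meets every vertex of `Δ[n]` and the end `1`. This rules out the last
horn and leaves, besides inner horns, only zeroth horns whose first edge is `Δ[1] × {0}`. -/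
theorem hasLift_prism_left {X S : SSet.{u}} {D : Set (S _⦋1⦌)} {p : X ⟶ S}
    (hp : SSet.InnerFibration p) (hD : LeftHornLifts D p) (n : ℕ) (v : Δ[1] ⊗ Δ[n] ⟶ S)
    (hv : v.app _ (edgeAt (SSet.stdSimplex.obj₀Equiv.symm 0)) ∈ D) :
    HasLiftingPropertyFixedBot (SSet.Subcomplex.unionProd Λ[1, 0] ∂Δ[n]).ι p v := by
  refine hasLift_of_pairing (SSet.prodStdSimplex.pairing 0 n) p v (fun d x i hx hi ↦ ?_)
  have hmono := (SSet.prodStdSimplex.nonDegenerate_iff_strictMono_objEquiv _).1 hx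
  obtain ⟨h2, a₁, h1⟩ := notMem_unionProd_horn_boundary hi
  obtain ⟨a₀, h0⟩ := h2 0
  obtain ⟨a₂, h2⟩ := h2 (Fin.last n)
  rw [SSet.prodStdSimplex.objEquiv_δ_apply] at h0 h1 h2
  set f := SSet.prodStdSimplex.objEquiv x with hf
  by_cases hi0 : i = 0
  -- Deleting vertex `0` of `x` still leaves a vertex over `0` in `Δ[n]`, so the first two vertices
  -- of `x` both lie over `0` and span `Δ[1] × {0}`.
  · subst hi0
    have e1 : (f 1).2 = 0 := le_antisymm
      ((f.monotone (Fin.one_le_of_ne_zero (Fin.succ_ne_zero a₀))).2.trans h0.le) (Fin.zero_le _)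
    have e0 : (f 0).2 = 0 := le_antisymm ((f.monotone (Fin.zero_le 1)).2.trans e1.le)
      (Fin.zero_le _)
    have hlt : (f 0).1 < (f 1).1 := by
      have := hmono (show (0 : Fin (d + 2)) < 1 from Fin.zero_lt_one)
      rw [Prod.lt_iff, e0, e1] at this
      simpa using this
    have e0' : (f 0).1 = 0 := (fin_two_eq_of_lt hlt).1
    have e1' : (f 1).1 = 1 := (fin_two_eq_of_lt hlt).2
    refine hD _ _ ?_
    convert hv using 1
    change v.app _ ((SSet.yonedaEquiv.symm x).app _ _) = _
    congr 1
    apply SSet.prodStdSimplex.objEquiv.injective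
    ext j : 2
    fin_cases j
    · exact Prod.ext e0' e0
    · exact Prod.ext e1' e1
  by_cases hil : i = Fin.last _
  -- The penultimate vertex would already be `(1, n)`, the maximum of the poset, contradicting
  -- strict monotonicity.
  · exfalso
    subst hil
    rw [Fin.succAbove_last] at h0 h1 h2
    have hlt := hmono (Fin.castSucc_lt_last (Fin.last d))
    have e1 : (f (Fin.last d).castSucc).1 ≠ 0 := by
      intro h
      exact h1 (le_antisymm ((f.monotone (Fin.castSucc_le_castSucc_iff.2 (Fin.le_last a₁))).1.trans
        h.le) (Fin.zero_le _))
    have e2 : (f (Fin.last d).castSucc).2 = Fin.last n :=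
      le_antisymm (Fin.le_last _)
        (h2.symm.le.trans (f.monotone (Fin.castSucc_le_castSucc_iff.2 (Fin.le_last a₂))).2)
    rw [Prod.lt_iff, e2] at hlt
    obtain ⟨h, -⟩ | ⟨-, h⟩ := hlt
    · exact e1 (fin_two_eq_of_lt h).1
    · exact h.not_ge (Fin.le_last _)
  · intro u sq
    have := hp.mem _ (SSet.horn_ι_mem_innerHornInclusions (Fin.pos_iff_ne_zero.2 hi0)
      (Fin.lt_last_iff_ne_last.2 hil))
    infer_instance

theorem hasLift_prism_right {X S : SSet.{u}} {D : Set (S _⦋1⦌)} {p : X ⟶ S}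
    (hp : SSet.InnerFibration p) (hD : RightHornLifts D p) (n : ℕ) (v : Δ[1] ⊗ Δ[n] ⟶ S)
    (hv : v.app _ (edgeAt (SSet.stdSimplex.obj₀Equiv.symm (Fin.last n))) ∈ D) :
    HasLiftingPropertyFixedBot (SSet.Subcomplex.unionProd Λ[1, 1] ∂Δ[n]).ι p v := by
  refine hasLift_of_pairing (SSet.prodStdSimplex.pairing 1 n) p v (fun d x i hx hi ↦ ?_)
  have hmono := (SSet.prodStdSimplex.nonDegenerate_iff_strictMono_objEquiv _).1 hx
  obtain ⟨h2, a₁, h1⟩ := notMem_unionProd_horn_boundary hi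
  obtain ⟨a₀, h0⟩ := h2 0
  obtain ⟨a₂, h2⟩ := h2 (Fin.last n)
  rw [SSet.prodStdSimplex.objEquiv_δ_apply] at h0 h1 h2
  set f := SSet.prodStdSimplex.objEquiv x with hf
  by_cases hil : i = Fin.last _
  · subst hil
    rw [Fin.succAbove_last] at h0 h1 h2
    have e0 : (f (Fin.last d).castSucc).2 = Fin.last n :=
      le_antisymm (Fin.le_last _)
        (h2.symm.le.trans (f.monotone (Fin.castSucc_le_castSucc_iff.2 (Fin.le_last a₂))).2)
    have e1 : (f (Fin.last (d + 1))).2 = Fin.last n :=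
      le_antisymm (Fin.le_last _) (e0.symm.le.trans (f.monotone (Fin.le_last _)).2)
    have hlt : (f (Fin.last d).castSucc).1 < (f (Fin.last (d + 1))).1 := by
      have := hmono (Fin.castSucc_lt_last (Fin.last d))
      rw [Prod.lt_iff, e0, e1] at this
      simpa using this
    have e0' : (f (Fin.last d).castSucc).1 = 0 := (fin_two_eq_of_lt hlt).1
    have e1' : (f (Fin.last (d + 1))).1 = 1 := (fin_two_eq_of_lt hlt).2
    refine hD _ _ ?_
    convert hv using 1
    change v.app _ ((SSet.yonedaEquiv.symm x).app _ _) = _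
    congr 1
    apply SSet.prodStdSimplex.objEquiv.injective
    ext j : 2
    fin_cases j
    · exact Prod.ext e0' e0
    · exact Prod.ext e1' e1
  by_cases hi0 : i = 0
  · exfalso
    subst hi0
    have hlt := hmono (show (0 : Fin (d + 2)) < 1 from Fin.zero_lt_one)
    have e1 : (f 1).1 ≠ 1 := by
      intro h
      exact h1 (le_antisymm (Fin.le_last _) (h.symm.le.trans
        (f.monotone (Fin.one_le_of_ne_zero (Fin.succ_ne_zero a₁))).1))
    have e2 : (f 1).2 = 0 := le_antisymm
      ((f.monotone (Fin.one_le_of_ne_zero (Fin.succ_ne_zero a₀))).2.trans h0.le) (Fin.zero_le _)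
    rw [Prod.lt_iff, e2] at hlt
    obtain ⟨h, -⟩ | ⟨-, h⟩ := hlt
    · exact e1 (fin_two_eq_of_lt h).2
    · exact h.not_ge (Fin.zero_le _)
  · intro u sq
    have := hp.mem _ (SSet.horn_ι_mem_innerHornInclusions (Fin.pos_iff_ne_zero.2 hi0)
      (Fin.lt_last_iff_ne_last.2 hil))
    infer_instance

end Cells

/-! ### Maps out of a subcomplex covered by a family of maps. -/

section Gluing

/-- Gluing of maps defined on a jointly surjective family of maps to a subcomplex. -/
theorem exists_glue {J : Type*} {T : J → SSet.{u}} {X Z : SSet.{u}} (A : X.Subcomplex)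
    (c : ∀ j, T j ⟶ X) (hc : ∀ n (x : X.obj n), x ∈ A.obj n → ∃ j t, (c j).app n t = x)
    (f : ∀ j, T j ⟶ Z)
    (hf : ∀ i j n (t : (T i).obj n) (t' : (T j).obj n),
      (c i).app n t = (c j).app n t' → (f i).app n t = (f j).app n t') :
    ∃ m : A.toSSet ⟶ Z, ∀ j n (t : (T j).obj n) (h : (c j).app n t ∈ A.obj n),
      m.app n ⟨(c j).app n t, h⟩ = (f j).app n t := by
  choose j t ht using hc
  refine ⟨{ app n := ↾fun x ↦ (f (j n x.1 x.2)).app n (t n x.1 x.2), naturality := ?_ }, ?_⟩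
  · intro n n' g
    ext ⟨x, hx⟩
    change (f _).app n' (t n' (X.map g x) _) = Z.map g ((f (j n x hx)).app n (t n x hx))
    rw [← NatTrans.naturality_apply]
    exact hf _ _ _ _ _ ((ht _ _ _).trans
      ((congrArg (X.map g) (ht n x hx)).symm.trans (NatTrans.naturality_apply (c _) g _).symm))
  · intro i n s h
    exact hf _ _ _ _ _ (ht n _ h)

theorem exists_glue_tensor {J : Type*} {T : J → SSet.{u}} {K X Z : SSet.{u}} (A : X.Subcomplex)
    (c : ∀ j, T j ⟶ X) (hc : ∀ n (x : X.obj n), x ∈ A.obj n → ∃ j t, (c j).app n t = x)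
    (f : ∀ j, K ⊗ T j ⟶ Z)
    (hf : ∀ i j n (a : K.obj n) (t : (T i).obj n) (t' : (T j).obj n),
      (c i).app n t = (c j).app n t' → (f i).app n ⟨a, t⟩ = (f j).app n ⟨a, t'⟩) :
    ∃ m : K ⊗ A.toSSet ⟶ Z, ∀ j n (a : K.obj n) (t : (T j).obj n) (h : (c j).app n t ∈ A.obj n),
      m.app n ⟨a, ⟨(c j).app n t, h⟩⟩ = (f j).app n ⟨a, t⟩ := by
  obtain ⟨m, hm⟩ := exists_glue ((⊤ : K.Subcomplex).prod A) (fun j ↦ K ◁ c j)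
    (fun n x hx ↦ by
      obtain ⟨j, t, ht⟩ := hc n x.2 hx.2
      exact ⟨j, ⟨x.1, t⟩, Prod.ext rfl ht⟩) f
    (fun i j n t t' h ↦ by
      obtain ⟨a, t⟩ := t
      obtain ⟨a', t'⟩ := t'
      obtain rfl : a = a' := congrArg Prod.fst h
      exact hf i j n a t t' (congrArg Prod.snd h))
  refine ⟨SSet.Subcomplex.lift (K ◁ A.ι) ?_ ≫ m, fun j n a t h ↦ hm j n ⟨a, t⟩ ⟨trivial, h⟩⟩
  rintro n _ ⟨⟨a, x⟩, rfl⟩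
  exact ⟨trivial, x.2⟩

end Gluing

/-! ### Cylinders and prism lifting. -/

/-- The inclusion `M ⟶ Δ[1] ⊗ M` at the vertex `k` of `Δ[1]`. -/
def inc (k : Fin 2) (M : SSet.{u}) : M ⟶ Δ[1] ⊗ M :=
  lift (SSet.const (SSet.stdSimplex.obj₀Equiv.symm k)) (𝟙 M)

@[simp]
lemma inc_snd_assoc (k : Fin 2) {M Z : SSet.{u}} (h : M ⟶ Z) :
    inc k M ≫ snd _ _ ≫ h = h := rfl

@[simp]
lemma inc_naturality_assoc (k : Fin 2) {M N Z : SSet.{u}} (f : M ⟶ N) (h : Δ[1] ⊗ N ⟶ Z) :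
    inc k M ≫ Δ[1] ◁ f ≫ h = f ≫ inc k N ≫ h := rfl

lemma mem_horn_one_iff (k : Fin 2) {n : SimplexCategoryᵒᵖ} (a : (Δ[1] : SSet.{u}).obj n) :
    a ∈ Λ[1, k].obj n ↔
      a = (SSet.stdSimplex.const 1 k n) := by
  obtain ⟨⟨n⟩⟩ := n
  rw [SSet.mem_horn_iff_notMem_range]
  constructor
  · rintro ⟨j, hj, h⟩
    refine SSet.stdSimplex.ext _ _ (fun i ↦ ?_)
    have : a i ≠ j := fun h' ↦ h ⟨i, h'⟩
    change a i = k
    have key : ∀ b j k : Fin 2, j ≠ k → b ≠ j → b = k := by decide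
    exact key _ _ _ hj this
  · rintro rfl
    obtain ⟨j, hj⟩ := exists_ne k
    exact ⟨j, hj, fun ⟨i, hi⟩ ↦ hj hi.symm⟩

/-- The first vertex (`k = 0`) or the last vertex (`k = 1`) of a standard simplex. -/
def endPt (k : Fin 2) (n : ℕ) : Fin (n + 1) := if k = 0 then 0 else Fin.last n

/-- The first vertex (`k = 0`) or the last vertex (`k = 1`) of a simplex. -/
def endVertex (k : Fin 2) {M : SSet.{u}} {n : ℕ} (x : M _⦋n⦌) : M _⦋0⦌ :=
  M.map (SimplexCategory.const ⦋0⦌ ⦋n⦌ (endPt k n)).op x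

lemma endVertex_app (k : Fin 2) {M M' : SSet.{u}} (f : M ⟶ M') {n : ℕ} (x : M _⦋n⦌) :
    endVertex k (f.app _ x) = f.app _ (endVertex k x) :=
  (NatTrans.naturality_apply f _ x).symm

lemma app_edgeAt {M M' : SSet.{u}} (f : M ⟶ M') (m : M _⦋0⦌) :
    (Δ[1] ◁ f).app _ (edgeAt m) = edgeAt (f.app _ m) :=
  Prod.ext rfl (show f.app _ (M.σ 0 m) = M'.σ 0 (f.app _ m) from
    NatTrans.naturality_apply f (SimplexCategory.σ 0).op m)

/-- The map `H : Δ[1] ⊗ M ⟶ S` sends the edge over the first vertex (`k = 0`), resp. over the last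
vertex (`k = 1`), of each simplex of `M` outside of `N` into the set `D`. -/
def EndEdges (k : Fin 2) {S M : SSet.{u}} (D : Set (S _⦋1⦌)) (N : M.Subcomplex)
    (H : Δ[1] ⊗ M ⟶ S) : Prop :=
  ∀ (n : ℕ) (x : M _⦋n⦌), x ∉ N.obj _ → H.app _ (edgeAt (endVertex k x)) ∈ D

/-- The lifting property of `p : X ⟶ S` with respect to the inclusions
`{k} ⊗ M ∪ Δ[1] ⊗ N ⟶ Δ[1] ⊗ M` over maps `Δ[1] ⊗ M ⟶ S` satisfying `EndEdges k D N`. -/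
def PrismLifts (k : Fin 2) {X S : SSet.{u}} (D : Set (S _⦋1⦌)) (p : X ⟶ S) : Prop :=
  ∀ (M : SSet.{u}) (N : M.Subcomplex) (H : Δ[1] ⊗ M ⟶ S), EndEdges k D N H →
    ∀ (b : M ⟶ X) (e : Δ[1] ⊗ N.toSSet ⟶ X), b ≫ p = inc k M ≫ H →
      e ≫ p = Δ[1] ◁ N.ι ≫ H → inc k N.toSSet ≫ e = N.ι ≫ b →
      ∃ G : Δ[1] ⊗ M ⟶ X, G ≫ p = H ∧ inc k M ≫ G = b ∧ Δ[1] ◁ N.ι ≫ G = e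

lemma congr_app_apply {X Y : SSet.{u}} {f g : X ⟶ Y} (h : f = g) (n : SimplexCategoryᵒᵖ)
    (x : X.obj n) : f.app n x = g.app n x := by
  rw [h]

lemma exists_lift_of_unionProd {k : Fin 2} {X S M : SSet.{u}} {p : X ⟶ S} {N : M.Subcomplex}
    {H : Δ[1] ⊗ M ⟶ S}
    (h : HasLiftingPropertyFixedBot (SSet.Subcomplex.unionProd Λ[1, k] N).ι p H)
    (b : M ⟶ X) (e : Δ[1] ⊗ N.toSSet ⟶ X) (hb : b ≫ p = inc k M ≫ H)
    (he : e ≫ p = Δ[1] ◁ N.ι ≫ H) (hbe : inc k N.toSSet ≫ e = N.ι ≫ b) :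
    ∃ G : Δ[1] ⊗ M ⟶ X, G ≫ p = H ∧ inc k M ≫ G = b ∧ Δ[1] ◁ N.ι ≫ G = e := by
  obtain ⟨m, hm⟩ := exists_glue (SSet.Subcomplex.unionProd Λ[1, k] N)
    (T := fun j : Bool ↦ bif j then M else Δ[1] ⊗ N.toSSet)
    (Bool.rec (Δ[1] ◁ N.ι) (inc k M))
    (fun n x hx ↦ by
      obtain h | h := (SSet.Subcomplex.mem_unionProd_iff _ _ x).1 hx
      · exact ⟨false, ⟨x.1, ⟨x.2, h⟩⟩, rfl⟩
      · exact ⟨true, x.2, Prod.ext ((mem_horn_one_iff k x.1).1 h).symm rfl⟩)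
    (Bool.rec e b) (by
      have key : ∀ n (t : M.obj n) (t' : (Δ[1] ⊗ N.toSSet).obj n),
          (inc k M).app n t = (Δ[1] ◁ N.ι).app n t' → b.app n t = e.app n t' := by
        rintro n t ⟨t', y⟩ h
        obtain rfl : SSet.stdSimplex.const 1 k n = t' := congrArg Prod.fst h
        obtain rfl : t = y.1 := congrArg Prod.snd h
        exact (congr_app_apply hbe n y).symm
      rintro (_ | _) (_ | _) n t t' h
      · obtain rfl : t = t' := Prod.ext (congrArg Prod.fst h :)
          (Subtype.ext (congrArg Prod.snd h :))
        rfl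
      · exact (key n t' t h.symm).symm
      · exact key n t t' h
      · obtain rfl : t = t' := congrArg Prod.snd h
        rfl)
  have hme : ∀ n t h, m.app n ⟨(Δ[1] ◁ N.ι).app n t, h⟩ = e.app n t := hm false
  have hmb : ∀ n t h, m.app n ⟨(inc k M).app n t, h⟩ = b.app n t := hm true
  have sq : CommSq m (SSet.Subcomplex.unionProd Λ[1, k] N).ι p H := ⟨by
    ext n ⟨x, hx⟩
    obtain h | h := (SSet.Subcomplex.mem_unionProd_iff _ _ x).1 hx
    · exact (congrArg (p.app n) (hme n ⟨x.1, ⟨x.2, h⟩⟩ hx)).trans (congr_app_apply he n _)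
    · obtain ⟨a, y⟩ := x
      obtain rfl := (mem_horn_one_iff k a).1 h
      exact (congrArg (p.app n) (hmb n y hx)).trans (congr_app_apply hb n _)⟩
  obtain ⟨⟨G, hG, hG'⟩⟩ := h m sq
  refine ⟨G, hG', ?_, ?_⟩
  · ext n x
    have hx := (SSet.Subcomplex.mem_unionProd_iff Λ[1, k] N ((inc k M).app n x)).2
      (Or.inr ((mem_horn_one_iff k _).2 rfl))
    exact (congr_app_apply hG n ⟨_, hx⟩).trans (hmb n x hx)
  · ext n x
    have hx := (SSet.Subcomplex.mem_unionProd_iff Λ[1, k] N ((Δ[1] ◁ N.ι).app n x)).2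
      (Or.inl x.2.2)
    exact (congr_app_apply hG n ⟨_, hx⟩).trans (hme n x hx)


/-- By adjunction, a prism problem is a lifting problem of `N.ι` against the map from the path
object of `X` to `X ×_S S^Δ[1]`. This can be solved one cell of `M` at a time, and `EndEdges` is
precisely the condition needed on the cells outside `N`. -/
theorem PrismLifts.of_boundary {k : Fin 2} {X S : SSet.{u}} {D : Set (S _⦋1⦌)} {p : X ⟶ S}
    (h : ∀ (n : ℕ) (v : Δ[1] ⊗ Δ[n] ⟶ S),
      v.app _ (edgeAt (SSet.stdSimplex.obj₀Equiv.symm (endPt k n))) ∈ D →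
      HasLiftingPropertyFixedBot (SSet.Subcomplex.unionProd Λ[1, k] ∂Δ[n]).ι p v) :
    PrismLifts k D p := by
  intro M N H hH b e hb he hbe
  let ev (W : SSet.{u}) : (ihom Δ[1]).obj W ⟶ W := inc k _ ≫ (ihom.ev Δ[1]).app W
  have hev {W T : SSet.{u}} (g : Δ[1] ⊗ T ⟶ W) : MonoidalClosed.curry g ≫ ev W = inc k T ≫ g := by
    rw [← inc_naturality_assoc, MonoidalClosed.whiskerLeft_curry_ihom_ev_app]
  have hev' {W T : SSet.{u}} (g : T ⟶ (ihom Δ[1]).obj W) :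
      g ≫ ev W = inc k T ≫ MonoidalClosed.uncurry g := by
    rw [← hev, MonoidalClosed.curry_uncurry]
  have hevp : ev X ≫ p = (ihom Δ[1]).map p ≫ ev S := by
    rw [hev']
    simp [ev, MonoidalClosed.uncurry_eq]
  let π : (ihom Δ[1]).obj X ⟶ pullback p (ev S) := pullback.lift (ev X) ((ihom Δ[1]).map p) hevp
  let bot : M ⟶ pullback p (ev S) := pullback.lift b (MonoidalClosed.curry H) (by rw [hev, hb])
  have hπ₁ : π ≫ pullback.fst p (ev S) = ev X := pullback.lift_fst _ _ _
  have hπ₂ : π ≫ pullback.snd p (ev S) = (ihom Δ[1]).map p := pullback.lift_snd _ _ _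
  have hbot₁ : bot ≫ pullback.fst p (ev S) = b := pullback.lift_fst _ _ _
  have hbot₂ : bot ≫ pullback.snd p (ev S) = MonoidalClosed.curry H := pullback.lift_snd _ _ _
  have key : HasLiftingPropertyFixedBot N.ι π bot := by
    refine hasLift_of_cells (SSet.relativeCellComplexOfMono N.ι) π bot (fun γ ↦ ?_)
    let c : SSet.relativeCellComplexOfMono.Cell N.ι γ.j := γ.k
    have h1 : γ.ι = c.map :=
      congrArg (· ≫ (SSet.skeletonOfMono N.ι (γ.j + 1)).ι) (Limits.Sigma.ι_desc _ c)
    have hH' : (Δ[1] ◁ γ.ι ≫ H).app _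
        (edgeAt (SSet.stdSimplex.obj₀Equiv.symm (endPt k γ.j))) ∈ D := by
      have h2 := hH _ c.simplex (fun h ↦ c.notMem ⟨⟨_, h⟩, rfl⟩)
      have h3 : γ.ι.app _ (SSet.stdSimplex.obj₀Equiv.symm (endPt k γ.j)) =
          endVertex k c.simplex := by
        rw [h1]
        rfl
      rw [← h3, ← app_edgeAt] at h2
      exact h2
    intro b' sq
    have w₁ : b' ≫ ev X = ∂Δ[γ.j].ι ≫ γ.ι ≫ b := by
      rw [← hπ₁, ← hbot₁]
      exact (sq.w =≫ pullback.fst _ _)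
    have w₂ : b' ≫ (ihom Δ[1]).map p = ∂Δ[γ.j].ι ≫ γ.ι ≫ MonoidalClosed.curry H := by
      rw [← hπ₂, ← hbot₂]
      exact (sq.w =≫ pullback.snd _ _)
    obtain ⟨G, hG₁, hG₂, hG₃⟩ := exists_lift_of_unionProd (h _ _ hH') (γ.ι ≫ b)
      (MonoidalClosed.uncurry b') (by rw [Category.assoc, hb, inc_naturality_assoc]) (by
        rw [← MonoidalClosed.uncurry_natural_right, w₂, MonoidalClosed.uncurry_natural_left,
          MonoidalClosed.uncurry_natural_left, MonoidalClosed.uncurry_curry]) (by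
        rw [← hev', w₁])
    refine ⟨⟨MonoidalClosed.curry G, ?_, ?_⟩⟩
    · rw [← MonoidalClosed.curry_natural_left, hG₃, MonoidalClosed.curry_uncurry]
    · apply pullback.hom_ext
      · rw [Category.assoc, Category.assoc, hπ₁, hbot₁, hev, hG₂]
      · rw [Category.assoc, Category.assoc, hπ₂, hbot₂, ← MonoidalClosed.curry_natural_right,
          hG₁, MonoidalClosed.curry_natural_left]
  obtain ⟨⟨G, hG, hG'⟩⟩ := key (MonoidalClosed.curry e) ⟨by
    apply pullback.hom_ext
    · rw [Category.assoc, Category.assoc, hπ₁, hbot₁, hev, hbe]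
    · rw [Category.assoc, Category.assoc, hπ₂, hbot₂, ← MonoidalClosed.curry_natural_right, he,
        MonoidalClosed.curry_natural_left]⟩
  refine ⟨MonoidalClosed.uncurry G, ?_, ?_, ?_⟩
  · rw [← MonoidalClosed.uncurry_natural_right, ← hπ₂, ← Category.assoc, hG', hbot₂,
      MonoidalClosed.uncurry_curry]
  · rw [← hev', ← hπ₁, ← Category.assoc, hG', hbot₁]
  · rw [← MonoidalClosed.uncurry_natural_left, hG, MonoidalClosed.uncurry_curry]

theorem IsBifibration.prismLifts_zero {A B X : SSet.{u}} {p : X ⟶ A ⊗ B} (hp : IsBifibration p) :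
    PrismLifts 0 {e | (snd A B).app _ e ∈ B.degenerate 1} p :=
  .of_boundary (fun n v hv ↦ hasLift_prism_left hp.inner
    (fun n v hv u sq ↦ hp.left_horn n u v sq hv) n v hv)

theorem IsBifibration.prismLifts_one {A B X : SSet.{u}} {p : X ⟶ A ⊗ B} (hp : IsBifibration p) :
    PrismLifts 1 {e | (fst A B).app _ e ∈ A.degenerate 1} p :=
  .of_boundary (fun n v hv ↦ hasLift_prism_right hp.inner
    (fun n v hv u sq ↦ hp.right_horn n u v sq hv) n v hv)

lemma mem_boundary_one_iff {n : SimplexCategoryᵒᵖ} (a : (Δ[1] : SSet.{u}).obj n) :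
    a ∈ ∂Δ[1].obj n ↔ ∃ k, a = SSet.stdSimplex.const 1 k n := by
  obtain ⟨⟨n⟩⟩ := n
  rw [SSet.mem_boundary_iff_notMem_range]
  constructor
  · rintro ⟨j, h⟩
    obtain ⟨k, hk⟩ := exists_ne j
    refine ⟨k, (mem_horn_one_iff k a).1 ?_⟩
    rw [SSet.mem_horn_iff_notMem_range]
    exact ⟨j, hk.symm, h⟩
  · rintro ⟨k, rfl⟩
    obtain ⟨j, hj⟩ := exists_ne k
    exact ⟨j, fun ⟨i, hi⟩ ↦ hj hi.symm⟩

lemma const_one_injective {n : SimplexCategoryᵒᵖ} {k k' : Fin 2}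
    (h : SSet.stdSimplex.const.{u} 1 k n = SSet.stdSimplex.const 1 k' n) : k = k' := by
  obtain ⟨⟨n⟩⟩ := n
  exact DFunLike.congr_fun h (0 : Fin (n + 1))

lemma EndEdges.whiskerLeft {k : Fin 2} {S M M' : SSet.{u}} {D : Set (S _⦋1⦌)} {N : M.Subcomplex}
    {H : Δ[1] ⊗ M ⟶ S} (hH : EndEdges k D N H) (N' : M'.Subcomplex) (f : M' ⟶ M)
    (hf : ∀ n x, x ∉ N'.obj n → f.app n x ∉ N.obj n) : EndEdges k D N' (Δ[1] ◁ f ≫ H) := by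
  intro n x hx
  have := hH n _ (hf _ x hx)
  rw [endVertex_app, ← app_edgeAt] at this
  exact this

theorem PrismLifts.exists_lift {k : Fin 2} {X S M : SSet.{u}} {D : Set (S _⦋1⦌)} {p : X ⟶ S}
    (hp : PrismLifts k D p) (H : Δ[1] ⊗ M ⟶ S) (hH : EndEdges k D ⊥ H) (b : M ⟶ X)
    (hb : b ≫ p = inc k M ≫ H) : ∃ G : Δ[1] ⊗ M ⟶ X, G ≫ p = H ∧ inc k M ≫ G = b := by
  -- Gluing the empty family gives the map out of the empty cylinder `Δ[1] ⊗ ⊥`.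
  obtain ⟨e, -⟩ := exists_glue_tensor (J := PEmpty.{1}) (T := fun _ ↦ M) (K := Δ[1]) (Z := X)
    (⊥ : M.Subcomplex) PEmpty.rec (fun n x hx ↦ hx.elim) PEmpty.rec (fun i ↦ i.elim)
  obtain ⟨G, h1, h2, -⟩ := hp M ⊥ H hH b e hb
    (by ext n ⟨a, x⟩; exact x.2.elim) (by ext n x; exact x.2.elim)
  exact ⟨G, h1, h2⟩

/-- Lifting along prisms over a cylinder both of whose ends are prescribed. -/
theorem PrismLifts.exists_double_lift {k : Fin 2} {X S M : SSet.{u}} {D : Set (S _⦋1⦌)} {p : X ⟶ S}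
    (hp : PrismLifts k D p) (N : M.Subcomplex) (H : Δ[1] ⊗ (Δ[1] ⊗ M) ⟶ S)
    (hH : EndEdges k D (SSet.Subcomplex.unionProd ∂Δ[1] N) H)
    (b : Δ[1] ⊗ M ⟶ X) (c : Fin 2 → (Δ[1] ⊗ M ⟶ X)) (e : Δ[1] ⊗ (Δ[1] ⊗ N.toSSet) ⟶ X)
    (hb : b ≫ p = inc k _ ≫ H) (hc : ∀ j, c j ≫ p = Δ[1] ◁ inc j M ≫ H)
    (he : e ≫ p = Δ[1] ◁ (Δ[1] ◁ N.ι) ≫ H) (hbc : ∀ j, inc k M ≫ c j = inc j M ≫ b)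
    (hbe : inc k _ ≫ e = Δ[1] ◁ N.ι ≫ b)
    (hce : ∀ j, Δ[1] ◁ inc j N.toSSet ≫ e = Δ[1] ◁ N.ι ≫ c j) :
    ∃ G : Δ[1] ⊗ (Δ[1] ⊗ M) ⟶ X, G ≫ p = H ∧ inc k _ ≫ G = b ∧
      (∀ j, Δ[1] ◁ inc j M ≫ G = c j) ∧ Δ[1] ◁ (Δ[1] ◁ N.ι) ≫ G = e := by
  obtain ⟨m, hm⟩ := exists_glue_tensor (K := Δ[1]) (Z := X)
    (SSet.Subcomplex.unionProd ∂Δ[1] N)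
    (T := fun j : Option (Fin 2) ↦ j.elim (Δ[1] ⊗ N.toSSet) (fun _ ↦ M))
    (Option.rec (Δ[1] ◁ N.ι) (fun j ↦ inc j M))
    (fun n x hx ↦ by
      obtain h | h := (SSet.Subcomplex.mem_unionProd_iff _ _ x).1 hx
      · exact ⟨none, ⟨x.1, ⟨x.2, h⟩⟩, rfl⟩
      · obtain ⟨k, hk⟩ := (mem_boundary_one_iff x.1).1 h
        exact ⟨some k, x.2, Prod.ext hk.symm rfl⟩)
    (Option.rec e c) (by
      have key : ∀ j n a (t : M.obj n) (t' : (Δ[1] ⊗ N.toSSet).obj n),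
          (inc j M).app n t = (Δ[1] ◁ N.ι).app n t' →
            (c j).app n ⟨a, t⟩ = e.app n ⟨a, t'⟩ := by
        rintro j n a t ⟨t', y⟩ h
        obtain rfl : SSet.stdSimplex.const 1 j n = t' := congrArg Prod.fst h
        obtain rfl : t = y.1 := congrArg Prod.snd h
        exact (congr_app_apply (hce j) n ⟨a, y⟩).symm
      rintro (_ | i) (_ | j) n a t t' h
      · obtain rfl : t = t' := Prod.ext (congrArg Prod.fst h :)
          (Subtype.ext (congrArg Prod.snd h :))
        rfl
      · exact (key j n a t' t h.symm).symm
      · exact key i n a t t' h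
      · obtain rfl : t = t' := congrArg Prod.snd h
        obtain rfl : i = j := const_one_injective (congrArg Prod.fst h)
        rfl)
  have hme : ∀ n a t h, m.app n ⟨a, ⟨(Δ[1] ◁ N.ι).app n t, h⟩⟩ = e.app n ⟨a, t⟩ := hm none
  have hmc : ∀ j n a t h, m.app n ⟨a, ⟨(inc j M).app n t, h⟩⟩ = (c j).app n ⟨a, t⟩ :=
    fun j ↦ hm (some j)
  have hmem {n : SimplexCategoryᵒᵖ} {x : (Δ[1] ⊗ M).obj n}
      {P : (Δ[1] ⊗ M).obj n → Prop} (hx : x ∈ (SSet.Subcomplex.unionProd ∂Δ[1] N).obj n)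
      (h₁ : ∀ t, P ((Δ[1] ◁ N.ι).app n t)) (h₂ : ∀ j t, P ((inc j M).app n t)) : P x := by
    obtain h | h := (SSet.Subcomplex.mem_unionProd_iff _ _ x).1 hx
    · exact h₁ ⟨x.1, ⟨x.2, h⟩⟩
    · obtain ⟨a, y⟩ := x
      obtain ⟨j, rfl⟩ := (mem_boundary_one_iff a).1 h
      exact h₂ j y
  obtain ⟨G, hG₁, hG₂, hG₃⟩ := hp _ _ H hH b m hb
    (by
      ext n ⟨a, ⟨x, hx⟩⟩
      revert hx
      refine fun hx ↦ hmem (P := fun x ↦ ∀ hx, (m ≫ p).app n ⟨a, ⟨x, hx⟩⟩ =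
        (Δ[1] ◁ (SSet.Subcomplex.unionProd ∂Δ[1] N).ι ≫ H).app n ⟨a, ⟨x, hx⟩⟩) hx ?_ ?_ hx
      · exact fun t h ↦ (congrArg (p.app n) (hme n a t h)).trans (congr_app_apply he n _)
      · exact fun j t h ↦ (congrArg (p.app n) (hmc j n a t h)).trans (congr_app_apply (hc j) n _))
    (by
      ext n ⟨x, hx⟩
      revert hx
      refine fun hx ↦ hmem (P := fun x ↦ ∀ hx, (inc k _ ≫ m).app n ⟨x, hx⟩ = b.app n x) hx ?_ ?_ hx
      · exact fun t h ↦ (hme n _ t h).trans (congr_app_apply hbe n _)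
      · exact fun j t h ↦ (hmc j n _ t h).trans (congr_app_apply (hbc j) n _))
  refine ⟨G, hG₁, hG₂, fun j ↦ ?_, ?_⟩
  · ext n ⟨a, x⟩
    have hx := (SSet.Subcomplex.mem_unionProd_iff ∂Δ[1] N ((inc j M).app n x)).2
      (Or.inr ((mem_boundary_one_iff _).2 ⟨j, rfl⟩))
    exact (congr_app_apply hG₃ n ⟨a, ⟨_, hx⟩⟩).trans (hmc j n a x hx)
  · ext n ⟨a, x⟩
    have hx := (SSet.Subcomplex.mem_unionProd_iff ∂Δ[1] N ((Δ[1] ◁ N.ι).app n x)).2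
      (Or.inl x.2.2)
    exact (congr_app_apply hG₃ n ⟨a, ⟨_, hx⟩⟩).trans (hme n a x hx)

/-! ### The mapping path space over a base. -/

/-- The symmetry of the double cylinder. -/
def cylSwap (M : SSet.{u}) : Δ[1] ⊗ (Δ[1] ⊗ M) ⟶ Δ[1] ⊗ (Δ[1] ⊗ M) :=
  lift (snd _ _ ≫ fst _ _) (Δ[1] ◁ snd _ _)

@[simp]
lemma inc_cylSwap_assoc (k : Fin 2) {M Z : SSet.{u}} (h : Δ[1] ⊗ (Δ[1] ⊗ M) ⟶ Z) :
    inc k _ ≫ cylSwap M ≫ h = Δ[1] ◁ inc k M ≫ h := rfl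

@[simp]
lemma whiskerLeft_inc_cylSwap_assoc (k : Fin 2) {M Z : SSet.{u}}
    (h : Δ[1] ⊗ (Δ[1] ⊗ M) ⟶ Z) : Δ[1] ◁ inc k M ≫ cylSwap M ≫ h = inc k _ ≫ h := rfl

lemma cylSwap_naturality_assoc {M N Z : SSet.{u}} (f : M ⟶ N)
    (h : Δ[1] ⊗ (Δ[1] ⊗ N) ⟶ Z) :
    Δ[1] ◁ Δ[1] ◁ f ≫ cylSwap N ≫ h = cylSwap M ≫ Δ[1] ◁ Δ[1] ◁ f ≫ h := rfl

@[simp]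
lemma cylSwap_cylSwap_assoc {M Z : SSet.{u}} (h : Δ[1] ⊗ (Δ[1] ⊗ M) ⟶ Z) :
    cylSwap M ≫ cylSwap M ≫ h = h := rfl

@[simp]
lemma cylSwap_whiskerLeft_snd_assoc {M Z : SSet.{u}} (h : Δ[1] ⊗ M ⟶ Z) :
    cylSwap M ≫ Δ[1] ◁ snd _ _ ≫ h = snd _ _ ≫ h := rfl

/-- A map `f : X ⟶ Y` over `S`, with its mapping path space `P`: maps `M ⟶ P` correspond to maps
`u : M ⟶ X` together with a homotopy over `S` from `u ≫ f` to some map `M ⟶ Y`. -/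
structure PathSpace {X Y S : SSet.{u}} (p : X ⟶ S) (q : Y ⟶ S) (f : X ⟶ Y) where
  /-- the mapping path space -/
  P : SSet.{u}
  /-- the projection to the source -/
  r : P ⟶ X
  /-- the evaluation of paths -/
  ev : Δ[1] ⊗ P ⟶ Y
  inc_ev : inc 0 P ≫ ev = r ≫ f
  ev_comp : ev ≫ q = snd _ _ ≫ r ≫ p
  exists_lift {M : SSet.{u}} (u : M ⟶ X) (h : Δ[1] ⊗ M ⟶ Y) :
    inc 0 M ≫ h = u ≫ f → h ≫ q = snd _ _ ≫ u ≫ p → ∃ m : M ⟶ P, m ≫ r = u ∧ Δ[1] ◁ m ≫ ev = h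
  hom_ext {M : SSet.{u}} {m m' : M ⟶ P} :
    m ≫ r = m' ≫ r → Δ[1] ◁ m ≫ ev = Δ[1] ◁ m' ≫ ev → m = m'

/-- The mapping path space of a map over `S`. -/
def pathSpace {X Y S : SSet.{u}} (p : X ⟶ S) (q : Y ⟶ S) (f : X ⟶ Y) : PathSpace p q f :=
  let α : X ⟶ Y ⊗ (ihom Δ[1]).obj S := lift f (MonoidalClosed.curry (snd _ _ ≫ p))
  let β : (ihom Δ[1]).obj Y ⟶ Y ⊗ (ihom Δ[1]).obj S :=
    lift (inc 0 _ ≫ (ihom.ev Δ[1]).app Y) ((ihom Δ[1]).map q)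
  { P := pullback α β
    r := pullback.fst α β
    ev := MonoidalClosed.uncurry (pullback.snd α β)
    inc_ev := by
      have h := (pullback.condition (f := α) (g := β)) =≫ fst _ _
      simp only [α, β, Category.assoc, lift_fst] at h
      rw [h, MonoidalClosed.uncurry_eq, inc_naturality_assoc]
    ev_comp := by
      have h := (pullback.condition (f := α) (g := β)) =≫ snd _ _
      simp only [α, β, Category.assoc, lift_snd] at h
      rw [← MonoidalClosed.uncurry_natural_right, ← h, MonoidalClosed.uncurry_natural_left,
        MonoidalClosed.uncurry_curry]
      rfl
    exists_lift := by
      intro M u h h₁ h₂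
      refine ⟨pullback.lift u (MonoidalClosed.curry h) ?_, pullback.lift_fst _ _ _, ?_⟩
      · apply CartesianMonoidalCategory.hom_ext
        · simp only [α, β, Category.assoc, lift_fst]
          rw [← h₁, ← inc_naturality_assoc, MonoidalClosed.whiskerLeft_curry_ihom_ev_app]
        · simp only [α, β, Category.assoc, lift_snd]
          rw [← MonoidalClosed.curry_natural_right, h₂, ← MonoidalClosed.curry_natural_left]
          rfl
      · rw [← MonoidalClosed.uncurry_natural_left, pullback.lift_snd, MonoidalClosed.uncurry_curry]
    hom_ext := by
      intro M m m' h₁ h₂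
      rw [← MonoidalClosed.uncurry_natural_left, ← MonoidalClosed.uncurry_natural_left] at h₂
      exact pullback.hom_ext h₁ (MonoidalClosed.uncurry_injective h₂) }

namespace PathSpace

variable {X Y S : SSet.{u}} {p : X ⟶ S} {q : Y ⟶ S} {f : X ⟶ Y} (Z : PathSpace p q f)

/-- The evaluation at the end of paths. -/
def g : Z.P ⟶ Y := inc 1 _ ≫ Z.ev

lemma g_comp : Z.g ≫ q = Z.r ≫ p := by
  rw [g, Category.assoc, Z.ev_comp, inc_snd_assoc]

/-- A lift to `P` is a lift `U` to `X` together with a homotopy from `U ≫ f` to the given `H`. After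
`U` is found by `hp`, the homotopy is a double cylinder in `Y` with both path ends and one end of
the prism prescribed. The first `Δ[1]` is the prism direction and the second the path direction;
`cylSwap` exchanges them to match `PathSpace.ev`. -/
theorem prismLifts_g (w : f ≫ q = p) {k : Fin 2} {D : Set (S _⦋1⦌)} (hp : PrismLifts k D p)
    (hq : PrismLifts k D q) : PrismLifts k (q.app _ ⁻¹' D) Z.g := by
  intro M N H hH b e hb he hbe
  have hHq : EndEdges k D N (H ≫ q) := hH
  obtain ⟨U, hU₁, hU₂, hU₃⟩ := hp M N (H ≫ q) hHq (b ≫ Z.r) (e ≫ Z.r)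
    (by rw [Category.assoc, ← g_comp, reassoc_of% hb])
    (by rw [Category.assoc, ← g_comp, reassoc_of% he])
    (by rw [reassoc_of% hbe])
  obtain ⟨G, hG₁, hG₂, hG₃, hG₄⟩ := hq.exists_double_lift N (Δ[1] ◁ snd _ _ ≫ H ≫ q)
    (hHq.whiskerLeft _ _ (fun n x hx h ↦
      hx ((SSet.Subcomplex.mem_unionProd_iff _ _ x).2 (Or.inl h))))
    (Δ[1] ◁ b ≫ Z.ev) ![U ≫ f, H] (cylSwap _ ≫ Δ[1] ◁ e ≫ Z.ev)
    (by
      rw [Category.assoc, Z.ev_comp, whiskerLeft_snd_assoc, ← g_comp, reassoc_of% hb]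
      rfl)
    (Fin.forall_fin_two.2 ⟨by
      change (U ≫ f) ≫ q = Δ[1] ◁ inc 0 M ≫ Δ[1] ◁ snd _ _ ≫ H ≫ q
      rw [Category.assoc, w, hU₁]
      rfl, rfl⟩)
    (by
      rw [Category.assoc, Category.assoc, Z.ev_comp, whiskerLeft_snd_assoc, ← g_comp,
        reassoc_of% he]
      rfl)
    (Fin.forall_fin_two.2 ⟨by
      change inc k M ≫ U ≫ f = inc 0 M ≫ Δ[1] ◁ b ≫ Z.ev
      rw [reassoc_of% hU₂, inc_naturality_assoc, Z.inc_ev], by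
      change inc k M ≫ H = inc 1 M ≫ Δ[1] ◁ b ≫ Z.ev
      rw [← hb, g, inc_naturality_assoc]⟩)
    (by
      rw [inc_cylSwap_assoc, ← whiskerLeft_comp_assoc, hbe, whiskerLeft_comp_assoc])
    (Fin.forall_fin_two.2 ⟨by
      change _ = Δ[1] ◁ N.ι ≫ U ≫ f
      rw [whiskerLeft_inc_cylSwap_assoc, inc_naturality_assoc, Z.inc_ev, reassoc_of% hU₃], by
      change _ = Δ[1] ◁ N.ι ≫ H
      rw [whiskerLeft_inc_cylSwap_assoc, inc_naturality_assoc, ← he, g]⟩)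
  have hG₀ : Δ[1] ◁ inc 0 M ≫ G = U ≫ f := hG₃ 0
  have hG₁' : Δ[1] ◁ inc 1 M ≫ G = H := hG₃ 1
  obtain ⟨m, hm₁, hm₂⟩ := Z.exists_lift U (cylSwap _ ≫ G) (by rw [inc_cylSwap_assoc, hG₀])
    (by
      rw [Category.assoc, hG₁, cylSwap_whiskerLeft_snd_assoc, hU₁])
  refine ⟨m, ?_, Z.hom_ext ?_ ?_, Z.hom_ext ?_ ?_⟩
  · rw [g, ← inc_naturality_assoc, hm₂, inc_cylSwap_assoc, hG₁']
  · rw [Category.assoc, hm₁, hU₂]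
  · rw [whiskerLeft_comp_assoc, hm₂, whiskerLeft_inc_cylSwap_assoc, hG₂]
  · rw [Category.assoc, hm₁, hU₃]
  · rw [whiskerLeft_comp_assoc, hm₂, cylSwap_naturality_assoc, hG₄, cylSwap_cylSwap_assoc]

end PathSpace

/-! ### From unconditional prism lifting to horn filling and Kan complexes. -/

/-- The map `Δ[1] ⊗ Δ[m] ⟶ Δ[m']` given by a monotone map in two variables. -/
def ofMonotone₂ {m m' : ℕ} (φ : Fin 2 → Fin (m + 1) → Fin (m' + 1))
    (hφ : ∀ a a' b b', a ≤ a' → b ≤ b' → φ a b ≤ φ a' b') :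
    (Δ[1] ⊗ Δ[m] : SSet.{u}) ⟶ Δ[m'] where
  app _ := ↾fun x ↦ SSet.stdSimplex.objMk ⟨fun i ↦ φ (SSet.stdSimplex.asOrderHom x.1 i)
    (SSet.stdSimplex.asOrderHom x.2 i), fun _ _ h ↦
    hφ _ _ _ _ ((SSet.stdSimplex.asOrderHom x.1).monotone h)
      ((SSet.stdSimplex.asOrderHom x.2).monotone h)⟩
  naturality _ _ _ := rfl

lemma ofMonotone₂_app {m m' : ℕ} (φ : Fin 2 → Fin (m + 1) → Fin (m' + 1))
    (hφ : ∀ a a' b b', a ≤ a' → b ≤ b' → φ a b ≤ φ a' b') {n : ℕ}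
    (a : (Δ[1] : SSet.{u}) _⦋n⦌) (b : (Δ[m] : SSet.{u}) _⦋n⦌) (i : Fin (n + 1)) :
    ((ofMonotone₂ φ hφ).app (Opposite.op ⦋n⦌) ⟨a, b⟩ : (Δ[m'] : SSet.{u}) _⦋n⦌) i =
      φ (a i) (b i) := rfl

lemma inc_ofMonotone₂_app {m m' : ℕ} (φ : Fin 2 → Fin (m + 1) → Fin (m' + 1))
    (hφ : ∀ a a' b b', a ≤ a' → b ≤ b' → φ a b ≤ φ a' b') {n : ℕ} (k : Fin 2)
    (b : (Δ[m] : SSet.{u}) _⦋n⦌) (i : Fin (n + 1)) :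
    ((inc k Δ[m] ≫ ofMonotone₂ φ hφ).app (Opposite.op ⦋n⦌) b : (Δ[m'] : SSet.{u}) _⦋n⦌) i =
      φ k (b i) := rfl

/-- The deformation `R` preserves `N` and pushes `M` into `N` at the end `k`, so `u` itself supplies
the prism data over `R ≫ v`. At the end `k'`, where `R` is the identity, the lifted prism solves the
original problem. `R` need not fix `N` pointwise. -/
theorem PrismLifts.hasLiftingProperty_of_deformation {k k' : Fin 2} {X S M : SSet.{u}} {p : X ⟶ S}
    (hp : PrismLifts k Set.univ p) (N : M.Subcomplex) (R : Δ[1] ⊗ M ⟶ M)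
    (hR : inc k' M ≫ R = 𝟙 M)
    (hN : ∀ n a (x : M.obj n), x ∈ N.obj n → R.app n ⟨a, x⟩ ∈ N.obj n)
    (hM : ∀ n (x : M.obj n), (inc k M ≫ R).app n x ∈ N.obj n) :
    HasLiftingProperty N.ι p := by
  let ρ : Δ[1] ⊗ N.toSSet ⟶ N.toSSet := SSet.Subcomplex.lift (Δ[1] ◁ N.ι ≫ R) (by
    rintro n _ ⟨⟨a, x⟩, rfl⟩
    exact hN n a x x.2)
  have hρ : ρ ≫ N.ι = Δ[1] ◁ N.ι ≫ R := rfl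
  let β : M ⟶ N.toSSet := SSet.Subcomplex.lift (inc k M ≫ R) (by
    rintro n _ ⟨x, rfl⟩
    exact hM n x)
  have hβ : β ≫ N.ι = inc k M ≫ R := rfl
  refine ⟨fun {u v} sq ↦ ?_⟩
  obtain ⟨G, hG₁, -, hG₃⟩ := hp M N (R ≫ v) (fun _ _ _ ↦ trivial) (β ≫ u) (ρ ≫ u)
    (by rw [Category.assoc, sq.w, reassoc_of% hβ])
    (by rw [Category.assoc, sq.w, reassoc_of% hρ]) rfl
  have hρ' : inc k' _ ≫ ρ = 𝟙 _ := by
    rw [← cancel_mono N.ι, Category.assoc, hρ, inc_naturality_assoc, hR, Category.comp_id,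
      Category.id_comp]
  refine ⟨⟨inc k' M ≫ G, ?_, ?_⟩⟩
  · rw [← inc_naturality_assoc, hG₃, reassoc_of% hρ']
  · rw [Category.assoc, hG₁, reassoc_of% hR]

lemma mem_horn_iff' {n m : ℕ} {i : Fin (n + 2)} (x : (Δ[n + 1] : SSet.{u}) _⦋m⦌) :
    x ∈ Λ[n + 1, i].obj _ ↔ ∃ j, j ≠ i ∧ ∀ a, x a ≠ j := by
  rw [SSet.mem_horn_iff_notMem_range]
  simp

/-- Replacing a vertex `j` by `min j i` or `max j i` creates no new vertex other than `i`, so it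
preserves every face opposite to a vertex different from `i`, hence the horn. If `i` is not last,
`min` misses the last vertex; if `i` is last, `max` is constant and misses `0`. -/
theorem hasLiftingProperty_horn {X S : SSet.{u}} {p : X ⟶ S} (h₀ : PrismLifts 0 Set.univ p)
    (h₁ : PrismLifts 1 Set.univ p) (n : ℕ) (i : Fin (n + 2)) :
    HasLiftingProperty Λ[n + 1, i].ι p := by
  by_cases hi : i = Fin.last (n + 1)
  · refine h₁.hasLiftingProperty_of_deformation (k' := 0) _
      (ofMonotone₂ (fun a j ↦ if a = 0 then j else max j i) ?_) ?_ ?_ ?_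
    · intro a a' b b' h h'
      fin_cases a <;> fin_cases a' <;> simp at h ⊢ <;> grind
    · ext ⟨⟨m⟩⟩ x j
      exact congrArg Fin.val (inc_ofMonotone₂_app _ _ 0 x j)
    · rintro ⟨⟨m⟩⟩ a x hx
      obtain ⟨j, hj, hx⟩ := (mem_horn_iff' x).1 hx
      refine (mem_horn_iff' _).2 ⟨j, hj, fun b ↦ ?_⟩
      refine ne_of_eq_of_ne (ofMonotone₂_app _ _ a x b) ?_
      have := hx b
      grind
    · rintro ⟨⟨m⟩⟩ x
      refine (mem_horn_iff' _).2 ⟨0, by rw [hi]; exact (Fin.last_pos).ne, fun b ↦ ?_⟩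
      refine ne_of_eq_of_ne (inc_ofMonotone₂_app _ _ 1 x b) ?_
      subst hi
      simp
  · refine h₀.hasLiftingProperty_of_deformation (k' := 1) _
      (ofMonotone₂ (fun a j ↦ if a = 0 then min j i else j) ?_) ?_ ?_ ?_
    · intro a a' b b' h h'
      fin_cases a <;> fin_cases a' <;> simp at h ⊢ <;> grind
    · ext ⟨⟨m⟩⟩ x j
      exact congrArg Fin.val (inc_ofMonotone₂_app _ _ 1 x j)
    · rintro ⟨⟨m⟩⟩ a x hx
      obtain ⟨j, hj, hx⟩ := (mem_horn_iff' x).1 hx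
      refine (mem_horn_iff' _).2 ⟨j, hj, fun b ↦ ?_⟩
      refine ne_of_eq_of_ne (ofMonotone₂_app _ _ a x b) ?_
      have := hx b
      grind
    · rintro ⟨⟨m⟩⟩ x
      refine (mem_horn_iff' _).2 ⟨Fin.last _, Ne.symm hi, fun b ↦ ?_⟩
      refine ne_of_eq_of_ne (inc_ofMonotone₂_app _ _ 0 x b) ?_
      have := Fin.lt_last_iff_ne_last.2 hi
      grind

open SSet.modelCategoryQuillen in
theorem kanComplex_of_prismLifts {X : SSet.{u}}
    (h₀ : PrismLifts 0 Set.univ (SSet.stdSimplex.isTerminalObj₀.from X))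
    (h₁ : PrismLifts 1 Set.univ (SSet.stdSimplex.isTerminalObj₀.from X)) : SSet.KanComplex X := by
  refine (isFibrant_iff _).2 ⟨?_⟩
  rw [SSet.modelCategoryQuillen.fibrations_eq]
  intro _ _ _ hf
  simp only [SSet.modelCategoryQuillen.J, MorphismProperty.iSup_iff] at hf
  obtain ⟨n, ⟨i⟩⟩ := hf
  have := hasLiftingProperty_horn h₀ h₁ n i
  refine ⟨fun {t _} _ ↦ ?_⟩
  have sq : CommSq t Λ[n + 1, i].ι (SSet.stdSimplex.isTerminalObj₀.from _)
    (SSet.stdSimplex.isTerminalObj₀.from _) := ⟨SSet.stdSimplex.isTerminalObj₀.hom_ext _ _⟩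
  exact ⟨⟨sq.lift, sq.fac_left, terminal.hom_ext _ _⟩⟩

theorem PrismLifts.exists_lift_of_mono {k : Fin 2} {X S M N : SSet.{u}} {D : Set (S _⦋1⦌)}
    {p : X ⟶ S} (hp : PrismLifts k D p) (i : N ⟶ M) [Mono i] (H : Δ[1] ⊗ M ⟶ S)
    (hH : EndEdges k D (SSet.Subcomplex.range i) H)
    (b : M ⟶ X) (e : Δ[1] ⊗ N ⟶ X) (hb : b ≫ p = inc k M ≫ H)
    (he : e ≫ p = Δ[1] ◁ i ≫ H) (hbe : inc k N ≫ e = i ≫ b) :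
    ∃ G : Δ[1] ⊗ M ⟶ X, G ≫ p = H ∧ inc k M ≫ G = b ∧ Δ[1] ◁ i ≫ G = e := by
  have hi : inv (SSet.Subcomplex.toRange i) ≫ i = (SSet.Subcomplex.range i).ι := by
    rw [IsIso.inv_comp_eq, SSet.Subcomplex.toRange_ι]
  obtain ⟨G, h₁, h₂, h₃⟩ := hp M (SSet.Subcomplex.range i) H hH b
    (Δ[1] ◁ inv (SSet.Subcomplex.toRange i) ≫ e) hb
    (by rw [Category.assoc, he, ← whiskerLeft_comp_assoc, hi])
    (by rw [inc_naturality_assoc, hbe, reassoc_of% hi])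
  refine ⟨G, h₁, h₂, ?_⟩
  rw [← SSet.Subcomplex.toRange_ι i, whiskerLeft_comp_assoc, h₃, ← whiskerLeft_comp_assoc,
    IsIso.hom_inv_id, whiskerLeft_id, Category.id_comp]

/-! ### Mapping spaces over a base. -/

section mapOver

variable {X Y S M : SSet.{u}} {p : X ⟶ S} {q : Y ⟶ S}

/-- The map `M ⟶ mapOver p q` given by a map `X ⊗ M ⟶ Y` over `S`. -/
def mapOverCurry (h : X ⊗ M ⟶ Y) (w : h ≫ q = fst _ _ ≫ p) : M ⟶ mapOver p q :=
  pullback.lift (MonoidalClosed.curry h) (SSet.stdSimplex.isTerminalObj₀.from M) (by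
    rw [← MonoidalClosed.curry_natural_right, w, homVertex, ← MonoidalClosed.curry_natural_left]
    rfl)

/-- The map `X ⊗ M ⟶ Y` corresponding to a map `M ⟶ mapOver p q`. -/
def mapOverUncurry (m : M ⟶ mapOver p q) : X ⊗ M ⟶ Y :=
  MonoidalClosed.uncurry (m ≫ pullback.fst _ _)

lemma mapOverUncurry_comp (m : M ⟶ mapOver p q) : mapOverUncurry m ≫ q = fst _ _ ≫ p := by
  have h (t : M ⟶ Δ[0]) : MonoidalClosed.uncurry (t ≫ homVertex p) = fst _ _ ≫ p := by
    rw [homVertex, ← MonoidalClosed.curry_natural_left, MonoidalClosed.uncurry_curry]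
    rfl
  rw [mapOverUncurry, ← MonoidalClosed.uncurry_natural_right, Category.assoc, pullback.condition,
    ← Category.assoc, h]

@[simp]
lemma mapOverUncurry_curry (h : X ⊗ M ⟶ Y) (w : h ≫ q = fst _ _ ≫ p) :
    mapOverUncurry (mapOverCurry h w) = h := by
  rw [mapOverUncurry, mapOverCurry, pullback.lift_fst, MonoidalClosed.uncurry_curry]

lemma mapOverUncurry_naturality {M' : SSet.{u}} (f : M' ⟶ M) (m : M ⟶ mapOver p q) :
    mapOverUncurry (f ≫ m) = X ◁ f ≫ mapOverUncurry m := by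
  rw [mapOverUncurry, Category.assoc, MonoidalClosed.uncurry_natural_left]
  rfl

lemma mapOverUncurry_injective {m m' : M ⟶ mapOver p q}
    (h : mapOverUncurry m = mapOverUncurry m') : m = m' :=
  pullback.hom_ext (MonoidalClosed.uncurry_injective h)
    (SSet.stdSimplex.isTerminalObj₀.hom_ext _ _)

lemma mapOverUncurry_pre {X' : SSet.{u}} {p' : X' ⟶ S} (f : X' ⟶ X) (w : f ≫ p = p')
    (m : M ⟶ mapOver p q) :
    mapOverUncurry (m ≫ mapOverPre f w q) = f ▷ M ≫ mapOverUncurry m := by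
  rw [mapOverUncurry, mapOverPre, Category.assoc, pullback.lift_fst, ← Category.assoc,
    MonoidalClosed.uncurry_pre_app]
  rfl

/-- Uncurrying turns a prism problem for `N ⟶ M` into one for `X ⊗ N ⟶ X ⊗ M` against `q`. Its base
map is constant along the cylinder, so all the edges concerned are degenerate. -/
theorem prismLifts_mapOver {k : Fin 2} {D : Set (S _⦋1⦌)} (hD : S.degenerate 1 ⊆ D)
    (hq : PrismLifts k D q) :
    PrismLifts k Set.univ (SSet.stdSimplex.isTerminalObj₀.from (mapOver p q)) := by
  intro M N H hH b e hb he hbe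
  let σ (M : SSet.{u}) : X ⊗ (Δ[1] ⊗ M) ⟶ Δ[1] ⊗ (X ⊗ M) :=
    lift (snd _ _ ≫ fst _ _) (X ◁ snd _ _)
  let τ (M : SSet.{u}) : Δ[1] ⊗ (X ⊗ M) ⟶ X ⊗ (Δ[1] ⊗ M) :=
    lift (snd _ _ ≫ fst _ _) (Δ[1] ◁ snd _ _)
  have : Mono (X ◁ N.ι) := ⟨fun a b h ↦ CartesianMonoidalCategory.hom_ext _ _
    (by simpa using h =≫ fst _ _) (by rw [← cancel_mono N.ι]; simpa using h =≫ snd _ _)⟩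
  obtain ⟨G, hG₁, hG₂, hG₃⟩ := hq.exists_lift_of_mono (X ◁ N.ι) (snd _ _ ≫ fst _ _ ≫ p)
    (fun n x _ ↦ hD
      (SSet.degenerate_app_apply (SSet.σ_mem_degenerate (X ⊗ M) 0 _) (fst _ _ ≫ p)))
    (mapOverUncurry b) (τ _ ≫ mapOverUncurry e)
    (mapOverUncurry_comp b)
    (by rw [Category.assoc, mapOverUncurry_comp]; rfl)
    (by
      rw [← mapOverUncurry_naturality, ← hbe, mapOverUncurry_naturality]
      rfl)
  refine ⟨mapOverCurry (σ _ ≫ G) (by rw [Category.assoc, hG₁]; rfl),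
    SSet.stdSimplex.isTerminalObj₀.hom_ext _ _, mapOverUncurry_injective ?_,
    mapOverUncurry_injective ?_⟩
  · rw [mapOverUncurry_naturality, mapOverUncurry_curry, ← hG₂]
    rfl
  · rw [mapOverUncurry_naturality, mapOverUncurry_curry]
    have : X ◁ Δ[1] ◁ N.ι ≫ σ M = σ N.toSSet ≫ Δ[1] ◁ X ◁ N.ι := rfl
    rw [reassoc_of% this, hG₃]
    rfl

end mapOver

/-! ### Homotopies, and their effect on mapping spaces. -/

/-- The existence of a homotopy from `f` to `g`. -/
def Homotopic {X Y : SSet.{u}} (f g : X ⟶ Y) : Prop :=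
  ∃ H : Δ[1] ⊗ X ⟶ Y, inc 0 X ≫ H = f ∧ inc 1 X ≫ H = g

/-- The existence of a homotopy over `S` from `f` to `g`. -/
def HomotopicOver {X Y S : SSet.{u}} (p : X ⟶ S) (q : Y ⟶ S) (f g : X ⟶ Y) : Prop :=
  ∃ H : Δ[1] ⊗ X ⟶ Y, H ≫ q = snd _ _ ≫ p ∧ inc 0 X ≫ H = f ∧ inc 1 X ≫ H = g

namespace HomotopicOver

variable {X Y Z S : SSet.{u}} {p : X ⟶ S} {q : Y ⟶ S} {r : Z ⟶ S} {f g : X ⟶ Y}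

lemma precomp (h : HomotopicOver p q f g) (e : Z ⟶ X) (he : e ≫ p = r) :
    HomotopicOver r q (e ≫ f) (e ≫ g) := by
  obtain ⟨H, hH, rfl, rfl⟩ := h
  exact ⟨Δ[1] ◁ e ≫ H, by rw [Category.assoc, hH, whiskerLeft_snd_assoc, he], rfl, rfl⟩

lemma postcomp (h : HomotopicOver p q f g) (e : Y ⟶ Z) (he : e ≫ r = q) :
    HomotopicOver p r (f ≫ e) (g ≫ e) := by
  obtain ⟨H, hH, rfl, rfl⟩ := h
  exact ⟨H ≫ e, by rw [Category.assoc, he, hH], rfl, rfl⟩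

lemma nonempty_homotopy (h : HomotopicOver p q f g) (hf : f ≫ q = p) (hg : g ≫ q = p) (r : Z ⟶ S) :
    Nonempty (SSet.Homotopy (mapOverPre f hf r) (mapOverPre g hg r)) := by
  obtain ⟨H, hH, rfl, rfl⟩ := h
  let σ : X ⊗ (mapOver q r ⊗ Δ[1]) ⟶ Y ⊗ mapOver q r :=
    lift (lift (snd _ _ ≫ snd _ _) (fst _ _) ≫ H) (snd _ _ ≫ fst _ _)
  have hσ : (σ ≫ mapOverUncurry (𝟙 _)) ≫ r = fst _ _ ≫ p := by
    rw [Category.assoc, mapOverUncurry_comp, ← Category.assoc, lift_fst, Category.assoc, hH]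
    rfl
  refine ⟨{ h := mapOverCurry (σ ≫ mapOverUncurry (𝟙 _)) hσ, h₀ := ?_, h₁ := ?_, rel := ?_ }⟩
  · refine mapOverUncurry_injective ?_
    rw [mapOverUncurry_naturality, mapOverUncurry_curry]
    exact (mapOverUncurry_pre (inc 0 X ≫ H) hf (𝟙 _)).symm
  · refine mapOverUncurry_injective ?_
    rw [mapOverUncurry_naturality, mapOverUncurry_curry]
    exact (mapOverUncurry_pre (inc 1 X ≫ H) hg (𝟙 _)).symm
  · ext n ⟨x, _⟩
    exact x.2.elim

end HomotopicOver

lemma mapOverPre_comp {X Y Z W S : SSet.{u}} {p : X ⟶ S} {q : Y ⟶ S} {r : Z ⟶ S}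
    (f : X ⟶ Y) (hf : f ≫ q = p) (g : Y ⟶ Z) (hg : g ≫ r = q) (t : W ⟶ S) :
    mapOverPre g hg t ≫ mapOverPre f hf t =
      mapOverPre (f ≫ g) (by rw [Category.assoc, hg, hf]) t := by
  apply mapOverUncurry_injective
  rw [mapOverUncurry_pre, ← Category.id_comp (mapOverPre g hg t), mapOverUncurry_pre,
    ← Category.id_comp (mapOverPre (f ≫ g) _ t), mapOverUncurry_pre, comp_whiskerRight,
    Category.assoc]

lemma mapOverPre_id {X W S : SSet.{u}} (p : X ⟶ S) (t : W ⟶ S) :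
    mapOverPre (𝟙 X) (Category.id_comp p) t = 𝟙 _ := by
  apply mapOverUncurry_injective
  rw [← Category.id_comp (mapOverPre _ _ _), mapOverUncurry_pre, id_whiskerRight,
    Category.id_comp]

/-- A map over `S` with an inverse up to homotopy over `S` induces homotopy equivalences on
mapping spaces. -/
theorem isHomotopyEquivalence_mapOverPre {X Y W S : SSet.{u}} {p : X ⟶ S} {q : Y ⟶ S} {f : X ⟶ Y}
    (hf : f ≫ q = p) (g : Y ⟶ X) (hg : g ≫ p = q) (hfg : HomotopicOver p p (f ≫ g) (𝟙 X))
    (hgf : HomotopicOver q q (g ≫ f) (𝟙 Y)) (r : W ⟶ S) :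
    IsHomotopyEquivalence (mapOverPre f hf r) := by
  refine ⟨mapOverPre g hg r, ?_, ?_⟩
  · rw [mapOverPre_comp, ← mapOverPre_id]
    exact hgf.nonempty_homotopy _ _ r
  · rw [mapOverPre_comp, ← mapOverPre_id]
    exact hfg.nonempty_homotopy _ _ r

/-! ### Edges of mapping spaces as homotopies, and `π₀`. -/

section Edges

lemma π₀Rel_iff {Q : SSet.{u}} (x y : Δ[0] ⟶ Q) :
    SSet.π₀Rel (SSet.yonedaEquiv x) (SSet.yonedaEquiv y) ↔
      ∃ e : Δ[1] ⟶ Q, SSet.stdSimplex.δ 1 ≫ e = x ∧ SSet.stdSimplex.δ 0 ≫ e = y := by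
  constructor
  · rintro ⟨e⟩
    refine ⟨SSet.yonedaEquiv.symm e.edge, ?_, ?_⟩
    · apply SSet.yonedaEquiv.injective
      rw [SSet.stdSimplex.yonedaEquiv_δ_comp, Equiv.apply_symm_apply]
      exact e.src_eq
    · apply SSet.yonedaEquiv.injective
      rw [SSet.stdSimplex.yonedaEquiv_δ_comp, Equiv.apply_symm_apply]
      exact e.tgt_eq
  · rintro ⟨e, rfl, rfl⟩
    exact ⟨⟨SSet.yonedaEquiv e, (SSet.stdSimplex.yonedaEquiv_δ_comp e 1).symm,
      (SSet.stdSimplex.yonedaEquiv_δ_comp e 0).symm⟩⟩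

lemma from_comp_δ (X : SSet.{u}) (k l : Fin 2) (h : k ≠ l) :
    SSet.stdSimplex.isTerminalObj₀.from X ≫ SSet.stdSimplex.δ k =
      SSet.const (SSet.stdSimplex.obj₀Equiv.symm l) := by
  ext ⟨⟨n⟩⟩ x j
  refine congrArg Fin.val (?_ : Fin.succAbove k 0 = l)
  revert k l
  decide

/-- The isomorphism from `Δ[1] ⊗ X` to `X ⊗ Δ[1]`. -/
def cylFlip (X : SSet.{u}) : Δ[1] ⊗ X ⟶ X ⊗ Δ[1] := lift (snd _ _) (fst _ _)

/-- The inverse of `cylFlip`. -/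
def cylFlip' (X : SSet.{u}) : X ⊗ Δ[1] ⟶ Δ[1] ⊗ X := lift (snd _ _) (fst _ _)

lemma whiskerLeft_δ_comp_iff {X Y : SSet.{u}} {k l : Fin 2} (hkl : k ≠ l) (h : X ⊗ Δ[1] ⟶ Y)
    (f : X ⟶ Y) :
    X ◁ SSet.stdSimplex.δ k ≫ h = fst X Δ[0] ≫ f ↔ inc l X ≫ cylFlip X ≫ h = f := by
  have h₁ : X ◁ SSet.stdSimplex.δ k = fst X Δ[0] ≫ inc l X ≫ cylFlip X := by
    apply CartesianMonoidalCategory.hom_ext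
    · rfl
    · rw [whiskerLeft_snd,
        SSet.stdSimplex.isTerminalObj₀.hom_ext (snd X Δ[0]) (SSet.stdSimplex.isTerminalObj₀.from _),
        from_comp_δ _ _ _ hkl]
      rfl
  have h₂ : lift (𝟙 X) (SSet.stdSimplex.isTerminalObj₀.from X) ≫ fst _ _ = 𝟙 X := lift_fst _ _
  rw [h₁, Category.assoc, Category.assoc]
  refine ⟨fun h ↦ ?_, fun h ↦ by rw [h]⟩
  simpa only [reassoc_of% h₂] using
    congrArg (lift (𝟙 X) (SSet.stdSimplex.isTerminalObj₀.from X) ≫ ·) h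

lemma fst_comp_surjective {X Y : SSet.{u}} (h : X ⊗ Δ[0] ⟶ Y) : ∃ f : X ⟶ Y, h = fst _ _ ≫ f := by
  refine ⟨lift (𝟙 X) (SSet.stdSimplex.isTerminalObj₀.from X) ≫ h, ?_⟩
  rw [← Category.assoc]
  refine (Category.id_comp h).symm.trans (congrArg (· ≫ h) ?_)
  apply CartesianMonoidalCategory.hom_ext
  · simp
  · exact SSet.stdSimplex.isTerminalObj₀.hom_ext _ _

lemma fst_comp_injective {X Y : SSet.{u}} {f g : X ⟶ Y} (h : fst X Δ[0] ≫ f = fst _ _ ≫ g) :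
    f = g := by
  have h₂ : lift (𝟙 X) (SSet.stdSimplex.isTerminalObj₀.from X) ≫ fst _ _ = 𝟙 X := lift_fst _ _
  simpa only [reassoc_of% h₂] using
    congrArg (lift (𝟙 X) (SSet.stdSimplex.isTerminalObj₀.from X) ≫ ·) h

lemma π₀Rel_homVertex_iff {X Y : SSet.{u}} (f g : X ⟶ Y) :
    SSet.π₀Rel (SSet.yonedaEquiv (homVertex f)) (SSet.yonedaEquiv (homVertex g)) ↔
      Homotopic f g := by
  have key (e : Δ[1] ⟶ (ihom X).obj Y) (k l : Fin 2) (hkl : k ≠ l) (f : X ⟶ Y) :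
      SSet.stdSimplex.δ k ≫ e = homVertex f ↔
        inc l X ≫ cylFlip X ≫ MonoidalClosed.uncurry e = f := by
    rw [← whiskerLeft_δ_comp_iff hkl, ← MonoidalClosed.uncurry_natural_left,
      ← MonoidalClosed.uncurry_injective.eq_iff, homVertex, MonoidalClosed.uncurry_curry]
  rw [π₀Rel_iff]
  constructor
  · rintro ⟨e, h₁, h₂⟩
    exact ⟨cylFlip X ≫ MonoidalClosed.uncurry e, (key _ 1 0 (by decide) _).1 h₁,
      (key _ 0 1 (by decide) _).1 h₂⟩
  · rintro ⟨H, h₁, h₂⟩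
    refine ⟨MonoidalClosed.curry (cylFlip' X ≫ H), (key _ 1 0 (by decide) _).2 ?_,
      (key _ 0 1 (by decide) _).2 ?_⟩
    · rw [MonoidalClosed.uncurry_curry]
      exact h₁
    · rw [MonoidalClosed.uncurry_curry]
      exact h₂

lemma homVertex_surjective {X Y : SSet.{u}} (x : ((ihom X).obj Y) _⦋0⦌) :
    ∃ f : X ⟶ Y, SSet.yonedaEquiv (homVertex f) = x := by
  obtain ⟨f, hf⟩ := fst_comp_surjective (MonoidalClosed.uncurry (SSet.yonedaEquiv.symm x))
  refine ⟨f, ?_⟩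
  rw [homVertex, ← hf, MonoidalClosed.curry_uncurry, Equiv.apply_symm_apply]

lemma pre_app_homVertex {X Y K : SSet.{u}} (f : X ⟶ Y) (g : Y ⟶ K) :
    ((MonoidalClosed.pre f).app K).app _ (SSet.yonedaEquiv (homVertex g)) =
      SSet.yonedaEquiv (homVertex (f ≫ g)) := by
  rw [← homVertex_pre, SSet.yonedaEquiv_comp]

lemma mapπ₀_pre_eq_of_homotopic {X Y : SSet.{u}} {f g : X ⟶ Y} (h : Homotopic f g) (K : SSet.{u}) :
    SSet.mapπ₀ ((MonoidalClosed.pre f).app K) = SSet.mapπ₀ ((MonoidalClosed.pre g).app K) := by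
  funext x
  induction x with | mk x
  obtain ⟨φ, rfl⟩ := homVertex_surjective x
  obtain ⟨H, rfl, rfl⟩ := h
  rw [SSet.mapπ₀_mk, SSet.mapπ₀_mk, pre_app_homVertex, pre_app_homVertex]
  exact SSet.π₀.sound ((π₀Rel_homVertex_iff _ _).2 ⟨H ≫ φ, rfl, rfl⟩).some

theorem isWeakHomotopyEquivalence_of_inverse {X Y : SSet.{u}} (f : X ⟶ Y) (g : Y ⟶ X)
    (hfg : ∀ K, SSet.mapπ₀ ((MonoidalClosed.pre (f ≫ g)).app K) = id)
    (hgf : ∀ K, SSet.mapπ₀ ((MonoidalClosed.pre (g ≫ f)).app K) = id) :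
    IsWeakHomotopyEquivalence f := by
  intro K _
  refine Function.bijective_iff_has_inverse.2 ⟨SSet.mapπ₀ ((MonoidalClosed.pre g).app K),
    fun x ↦ ?_, fun x ↦ ?_⟩
  · rw [← SSet.mapπ₀_comp_apply, ← NatTrans.comp_app, ← MonoidalClosed.pre_map, hgf]
    rfl
  · rw [← SSet.mapπ₀_comp_apply, ← NatTrans.comp_app, ← MonoidalClosed.pre_map, hfg]
    rfl

/-- The vertex of the mapping space given by a map over `S`. -/
def mapOverVertex {X Y S : SSet.{u}} {p : X ⟶ S} {q : Y ⟶ S} (f : X ⟶ Y) (w : f ≫ q = p) :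
    Δ[0] ⟶ mapOver p q :=
  mapOverCurry (fst _ _ ≫ f) (by rw [Category.assoc, w])

lemma mapOverVertex_surjective {X Y S : SSet.{u}} {p : X ⟶ S} {q : Y ⟶ S} (x : Δ[0] ⟶ mapOver p q) :
    ∃ (f : X ⟶ Y) (w : f ≫ q = p), x = mapOverVertex f w := by
  obtain ⟨f, hf⟩ := fst_comp_surjective (mapOverUncurry x)
  refine ⟨f, fst_comp_injective ?_, mapOverUncurry_injective ?_⟩
  · rw [← mapOverUncurry_comp x, hf, Category.assoc]
  · exact hf.trans (mapOverUncurry_curry _ _).symm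

lemma mapOverVertex_pre {X X' Y S : SSet.{u}} {p : X ⟶ S} {p' : X' ⟶ S} {q : Y ⟶ S} (f : X ⟶ Y)
    (w : f ≫ q = p) (h : X' ⟶ X) (w' : h ≫ p = p') :
    mapOverVertex f w ≫ mapOverPre h w' q =
      mapOverVertex (h ≫ f) (by rw [Category.assoc, w, w']) := by
  apply mapOverUncurry_injective
  rw [mapOverUncurry_pre, mapOverVertex, mapOverVertex, mapOverUncurry_curry, mapOverUncurry_curry]
  simp

lemma exists_edge_mapOverVertex_iff {X Y S : SSet.{u}} {p : X ⟶ S} {q : Y ⟶ S} (f g : X ⟶ Y)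
    (hf : f ≫ q = p) (hg : g ≫ q = p) :
    (∃ e : Δ[1] ⟶ mapOver p q, SSet.stdSimplex.δ 1 ≫ e = mapOverVertex f hf ∧
      SSet.stdSimplex.δ 0 ≫ e = mapOverVertex g hg) ↔ HomotopicOver p q f g := by
  have key (e : Δ[1] ⟶ mapOver p q) (k l : Fin 2) (hkl : k ≠ l) (f : X ⟶ Y) (hf : f ≫ q = p) :
      SSet.stdSimplex.δ k ≫ e = mapOverVertex f hf ↔
        inc l X ≫ cylFlip X ≫ mapOverUncurry e = f := by
    rw [← whiskerLeft_δ_comp_iff hkl, ← mapOverUncurry_naturality, mapOverVertex]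
    refine ⟨fun h ↦ by rw [h, mapOverUncurry_curry], fun h ↦ mapOverUncurry_injective ?_⟩
    rw [h, mapOverUncurry_curry]
  constructor
  · rintro ⟨e, h₁, h₂⟩
    refine ⟨cylFlip X ≫ mapOverUncurry e, ?_, (key _ 1 0 (by decide) _ _).1 h₁,
      (key _ 0 1 (by decide) _ _).1 h₂⟩
    rw [Category.assoc, mapOverUncurry_comp]
    rfl
  · rintro ⟨H, hH, h₁, h₂⟩
    refine ⟨mapOverCurry (cylFlip' X ≫ H) (by rw [Category.assoc, hH]; rfl),
      (key _ 1 0 (by decide) _ _).2 ?_, (key _ 0 1 (by decide) _ _).2 ?_⟩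
    · rw [mapOverUncurry_curry]
      exact h₁
    · rw [mapOverUncurry_curry]
      exact h₂

lemma exists_edge_of_homotopy {Q Q' : SSet.{u}} {F G : Q ⟶ Q'} (h : SSet.Homotopy F G)
    (x : Δ[0] ⟶ Q) :
    ∃ e : Δ[1] ⟶ Q', SSet.stdSimplex.δ 1 ≫ e = x ≫ F ∧ SSet.stdSimplex.δ 0 ≫ e = x ≫ G := by
  have key (k l : Fin 2) (hkl : k ≠ l) : SSet.stdSimplex.δ k ≫
      lift (SSet.stdSimplex.isTerminalObj₀.from _ ≫ x) (𝟙 _) =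
        x ≫ lift (𝟙 Q) (SSet.const (SSet.stdSimplex.obj₀Equiv.symm l)) := by
    apply CartesianMonoidalCategory.hom_ext
    · rw [Category.assoc, lift_fst, Category.assoc, lift_fst, Category.comp_id, ← Category.assoc,
        SSet.stdSimplex.isTerminalObj₀.hom_ext (_ ≫ _) (𝟙 _), Category.id_comp]
    · rw [Category.assoc, lift_snd, Category.assoc, lift_snd, Category.comp_id,
        ← Category.id_comp (SSet.stdSimplex.δ k),
        SSet.stdSimplex.isTerminalObj₀.hom_ext (𝟙 Δ[0]) (SSet.stdSimplex.isTerminalObj₀.from _),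
        from_comp_δ _ _ _ hkl]
      rfl
  exact ⟨lift (SSet.stdSimplex.isTerminalObj₀.from _ ≫ x) (𝟙 _) ≫ h.h,
    (congrArg (· ≫ h.h) (key 1 0 (by decide))).trans (congrArg (x ≫ ·) h.h₀),
    (congrArg (· ≫ h.h) (key 0 1 (by decide))).trans (congrArg (x ≫ ·) h.h₁)⟩

end Edges

/-! ### Fibers and base change. -/

section Fibers

variable {X Y Z S : SSet.{u}} {p : X ⟶ S} {q : Y ⟶ S} {r : Z ⟶ S}

lemma fiberMap_fst (f : X ⟶ Y) (w : f ≫ q = p) (s : Δ[0] ⟶ S) :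
    fiberMap f w s ≫ pullback.fst q s = pullback.fst p s ≫ f := pullback.lift_fst _ _ _

lemma fiberMap_snd (f : X ⟶ Y) (w : f ≫ q = p) (s : Δ[0] ⟶ S) :
    fiberMap f w s ≫ pullback.snd q s = pullback.snd p s := pullback.lift_snd _ _ _

lemma fiberMap_comp (f : X ⟶ Y) (hf : f ≫ q = p) (g : Y ⟶ Z) (hg : g ≫ r = q) (s : Δ[0] ⟶ S) :
    fiberMap f hf s ≫ fiberMap g hg s =
      fiberMap (f ≫ g) (by rw [Category.assoc, hg, hf]) s := by
  apply pullback.hom_ext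
  · rw [fiberMap_fst, Category.assoc, fiberMap_fst, ← Category.assoc, fiberMap_fst, Category.assoc]
  · rw [fiberMap_snd, Category.assoc, fiberMap_snd, fiberMap_snd]

lemma fiberMap_id (s : Δ[0] ⟶ S) : fiberMap (𝟙 X) (Category.id_comp p) s = 𝟙 _ := by
  apply pullback.hom_ext
  · rw [fiberMap_fst, Category.comp_id, Category.id_comp]
  · rw [fiberMap_snd, Category.id_comp]

lemma HomotopicOver.fiberMap {f g : X ⟶ Y} (h : HomotopicOver p q f g) (hf : f ≫ q = p)
    (hg : g ≫ q = p) (s : Δ[0] ⟶ S) :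
    Homotopic (fiberMap f hf s) (Bivariant.fiberMap g hg s) := by
  obtain ⟨H, hH, rfl, rfl⟩ := h
  have w : (Δ[1] ◁ pullback.fst p s ≫ H) ≫ q = (snd _ _ ≫ pullback.snd p s) ≫ s := by
    rw [Category.assoc, hH, Category.assoc, ← pullback.condition]
    rfl
  have h₁ := pullback.lift_fst _ _ w
  have h₂ := pullback.lift_snd _ _ w
  refine ⟨pullback.lift _ _ w, ?_, ?_⟩
  · apply pullback.hom_ext
    · rw [Category.assoc, h₁, Bivariant.fiberMap, pullback.lift_fst]
      rfl
    · rw [Category.assoc, h₂, Bivariant.fiberMap, pullback.lift_snd]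
      rfl
  · apply pullback.hom_ext
    · rw [Category.assoc, h₁, Bivariant.fiberMap, pullback.lift_fst]
      rfl
    · rw [Category.assoc, h₂, Bivariant.fiberMap, pullback.lift_snd]
      rfl

theorem isPullback_fiberMap (f : X ⟶ Y) (w : f ≫ q = p) (s : Δ[0] ⟶ S) :
    IsPullback (pullback.fst p s) (fiberMap f w s) f (pullback.fst q s) := by
  refine IsPullback.of_bot (v₂₁ := pullback.snd q s) (v₂₂ := q) (h₃₁ := s) ?_ ?_
    (IsPullback.of_hasPullback q s)
  · rw [fiberMap, pullback.lift_snd, w]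
    exact IsPullback.of_hasPullback p s
  · rw [fiberMap, pullback.lift_fst]

theorem PrismLifts.of_isPullback {k : Fin 2} {X' X S' S : SSet.{u}} {t : X' ⟶ X} {p' : X' ⟶ S'}
    {p : X ⟶ S} {b : S' ⟶ S} (sq : IsPullback t p' p b) {D : Set (S _⦋1⦌)}
    (hp : PrismLifts k D p) : PrismLifts k (b.app _ ⁻¹' D) p' := by
  intro M N H hH c e hc he hce
  obtain ⟨G, h₁, h₂, h₃⟩ := hp M N (H ≫ b) hH (c ≫ t) (e ≫ t)
    (by rw [Category.assoc, sq.w, reassoc_of% hc]) (by rw [Category.assoc, sq.w, reassoc_of% he])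
    (by rw [reassoc_of% hce])
  refine ⟨sq.lift G H h₁, sq.lift_snd _ _ _, sq.hom_ext ?_ ?_, sq.hom_ext ?_ ?_⟩
  · rw [Category.assoc, sq.lift_fst, h₂]
  · rw [Category.assoc, sq.lift_snd, hc]
  · rw [Category.assoc, sq.lift_fst, h₃]
  · rw [Category.assoc, sq.lift_snd, he]

lemma PrismLifts.mono_set {k : Fin 2} {D D' : Set (S _⦋1⦌)} (h : PrismLifts k D p)
    (hD : D' ⊆ D) : PrismLifts k D' p :=
  fun M N H hH ↦ h M N H (fun n x hx ↦ hD (hH n x hx))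

lemma degenerate_deltaZero (x : (Δ[0] : SSet.{u}) _⦋1⦌) : x ∈ (Δ[0] : SSet.{u}).degenerate 1 := by
  have : x = (Δ[0] : SSet.{u}).σ 0 (SSet.stdSimplex.obj₀Equiv.symm 0) :=
    SSet.stdSimplex.ext _ _ (fun i ↦ Subsingleton.elim (α := Fin 1) _ _)
  rw [this]
  exact SSet.σ_mem_degenerate _ _ _

/-- Every edge of `Δ[0]` is degenerate, so the edge condition becomes void after base change to a
point. -/
theorem PrismLifts.from_fiber {k : Fin 2} {D : Set (S _⦋1⦌)} (hD : S.degenerate 1 ⊆ D)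
    (hp : PrismLifts k D p) (s : Δ[0] ⟶ S) :
    PrismLifts k Set.univ (SSet.stdSimplex.isTerminalObj₀.from (fiber p s)) := by
  rw [SSet.stdSimplex.isTerminalObj₀.hom_ext (SSet.stdSimplex.isTerminalObj₀.from (fiber p s))
    (pullback.snd p s)]
  exact (PrismLifts.of_isPullback (IsPullback.of_hasPullback p s) hp).mono_set
    (fun e _ ↦ hD (SSet.degenerate_app_apply (degenerate_deltaZero e) s))

theorem PrismLifts.fiberMap_univ {k : Fin 2} {D : Set (S _⦋1⦌)} (hD : S.degenerate 1 ⊆ D) {f : X ⟶ Y}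
    (w : f ≫ q = p) (hf : PrismLifts k (q.app _ ⁻¹' D) f) (s : Δ[0] ⟶ S) :
    PrismLifts k Set.univ (fiberMap f w s) := by
  refine (PrismLifts.of_isPullback (isPullback_fiberMap f w s) hf).mono_set (fun e _ ↦ ?_)
  change q.app _ ((pullback.fst q s).app _ e) ∈ D
  rw [show q.app _ ((pullback.fst q s).app _ e) = s.app _ ((pullback.snd q s).app _ e) from
    congr_app_apply pullback.condition _ e]
  exact hD (SSet.degenerate_app_apply (degenerate_deltaZero _) s)

theorem hasLift_of_fiberMap {f : X ⟶ Y} (w : f ≫ q = p) (s : Δ[0] ⟶ S) {N M : SSet.{u}} (i : N ⟶ M)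
    [HasLiftingProperty i (fiberMap f w s)] (v : M ⟶ Y)
    (hv : v ≫ q = SSet.stdSimplex.isTerminalObj₀.from M ≫ s) :
    HasLiftingPropertyFixedBot i f v := by
  intro u sq
  have sq' : CommSq ((isPullback_fiberMap f w s).lift u (i ≫ pullback.lift v _ hv)
      (by rw [sq.w, Category.assoc, pullback.lift_fst])) i (fiberMap f w s)
      (pullback.lift v _ hv) := ⟨IsPullback.lift_snd _ _ _ _⟩
  refine ⟨⟨sq'.lift ≫ pullback.fst p s, ?_, ?_⟩⟩
  · rw [← Category.assoc, sq'.fac_left, IsPullback.lift_fst]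
  · rw [Category.assoc, (isPullback_fiberMap f w s).w, ← Category.assoc, sq'.fac_right,
      pullback.lift_fst]

end Fibers

/-! ### Weak equivalences with prism lifting are trivial fibrations. -/

section Weak

variable {X Y : SSet.{u}}

lemma Homotopic.refl (f : X ⟶ Y) : Homotopic f f := ⟨snd _ _ ≫ f, rfl, rfl⟩

lemma Homotopic.precomp {Z : SSet.{u}} {f g : X ⟶ Y} (h : Homotopic f g) (e : Z ⟶ X) :
    Homotopic (e ≫ f) (e ≫ g) := by
  obtain ⟨H, rfl, rfl⟩ := h
  exact ⟨Δ[1] ◁ e ≫ H, rfl, rfl⟩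

lemma Homotopic.postcomp {Z : SSet.{u}} {f g : X ⟶ Y} (h : Homotopic f g) (e : Y ⟶ Z) :
    Homotopic (f ≫ e) (g ≫ e) := by
  obtain ⟨H, rfl, rfl⟩ := h
  exact ⟨H ≫ e, rfl, rfl⟩

/-- Fill a square of homotopies with sides `H₁`, `H₂` and a constant homotopy of `f` at the end `0`;
the edge at the end `1` runs from `g` to `h`. With reflexivity this gives both symmetry and
transitivity. -/
lemma Homotopic.trans_of_left (hY : PrismLifts 0 Set.univ (SSet.stdSimplex.isTerminalObj₀.from Y))
    {f g h : X ⟶ Y} (h₁ : Homotopic f g) (h₂ : Homotopic f h) : Homotopic g h := by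
  obtain ⟨H₁, rfl, rfl⟩ := h₁
  obtain ⟨H₂, h₂₁, rfl⟩ := h₂
  obtain ⟨G, -, -, hG, -⟩ := hY.exists_double_lift (⊥ : X.Subcomplex)
    (SSet.stdSimplex.isTerminalObj₀.from _) (fun _ _ _ ↦ trivial) (snd _ _ ≫ inc 0 X ≫ H₁) ![H₁, H₂]
    (Δ[1] ◁ Δ[1] ◁ (⊥ : X.Subcomplex).ι ≫ Δ[1] ◁ snd _ _ ≫ H₁)
    (SSet.stdSimplex.isTerminalObj₀.hom_ext _ _)
    (fun _ ↦ SSet.stdSimplex.isTerminalObj₀.hom_ext _ _)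
    (SSet.stdSimplex.isTerminalObj₀.hom_ext _ _)
    (Fin.forall_fin_two.2 ⟨by
      change inc 0 X ≫ H₁ = _
      rw [inc_snd_assoc], by
      change inc 0 X ≫ H₂ = _
      rw [inc_snd_assoc, h₂₁]⟩)
    (by ext n ⟨_, x⟩; exact x.2.elim) (fun j ↦ by ext n ⟨_, x⟩; exact x.2.elim)
  have hG₀ : Δ[1] ◁ inc 0 X ≫ G = H₁ := hG 0
  have hG₁ : Δ[1] ◁ inc 1 X ≫ G = H₂ := hG 1
  exact ⟨inc 1 _ ≫ G, by rw [← inc_naturality_assoc, hG₀], by rw [← inc_naturality_assoc, hG₁]⟩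

theorem homotopic_of_π₀_eq
    (hY : PrismLifts 0 Set.univ (SSet.stdSimplex.isTerminalObj₀.from Y)) {f g : X ⟶ Y}
    (h : SSet.π₀.mk (SSet.yonedaEquiv (homVertex f)) =
      SSet.π₀.mk (SSet.yonedaEquiv (homVertex g))) : Homotopic f g := by
  have heq : Equivalence (SSet.π₀Rel (X := (ihom X).obj Y)) := by
    have refl (x) : SSet.π₀Rel (X := (ihom X).obj Y) x x := by
      obtain ⟨f, rfl⟩ := homVertex_surjective x
      exact (π₀Rel_homVertex_iff _ _).2 (.refl f)
    have trans' (x y z) (h₁ : SSet.π₀Rel (X := (ihom X).obj Y) x y) (h₂ : SSet.π₀Rel x z) :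
        SSet.π₀Rel y z := by
      obtain ⟨f, rfl⟩ := homVertex_surjective x
      obtain ⟨g, rfl⟩ := homVertex_surjective y
      obtain ⟨h, rfl⟩ := homVertex_surjective z
      rw [π₀Rel_homVertex_iff] at h₁ h₂ ⊢
      exact h₁.trans_of_left hY h₂
    exact ⟨refl, fun h ↦ trans' _ _ _ h (refl _),
      fun h h' ↦ trans' _ _ _ (trans' _ _ _ h (refl _)) h'⟩
  rw [SSet.π₀.mk_eq_mk_iff, heq.eqvGen_iff] at h
  exact (π₀Rel_homVertex_iff _ _).1 h

/-- Testing against the Kan complexes `X` and `Y` gives a homotopy inverse `s₀`. Lifting the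
homotopy from `s₀ ≫ π` to `𝟙 Y` along `π`, starting at `s₀`, moves `s₀` to a strict section. -/
theorem exists_section_of_isWeakHomotopyEquivalence {π : X ⟶ Y}
    (hX : ∀ k, PrismLifts k Set.univ (SSet.stdSimplex.isTerminalObj₀.from X))
    (hY : ∀ k, PrismLifts k Set.univ (SSet.stdSimplex.isTerminalObj₀.from Y))
    (hπ : PrismLifts 0 Set.univ π) (h : IsWeakHomotopyEquivalence π) :
    ∃ s : Y ⟶ X, s ≫ π = 𝟙 Y ∧ Homotopic (π ≫ s) (𝟙 X) := by
  obtain ⟨x, hx⟩ := (h X (kanComplex_of_prismLifts (hX 0) (hX 1))).2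
    (SSet.π₀.mk (SSet.yonedaEquiv (homVertex (𝟙 X))))
  induction x with | mk x
  obtain ⟨s₀, rfl⟩ := homVertex_surjective x
  rw [SSet.mapπ₀_mk, pre_app_homVertex] at hx
  have h₀ := homotopic_of_π₀_eq (hX 0) hx
  have h₁ : Homotopic (s₀ ≫ π) (𝟙 Y) := by
    apply homotopic_of_π₀_eq (hY 0)
    apply (h Y (kanComplex_of_prismLifts (hY 0) (hY 1))).1
    rw [SSet.mapπ₀_mk, SSet.mapπ₀_mk, pre_app_homVertex, pre_app_homVertex]
    refine SSet.π₀.sound ((π₀Rel_homVertex_iff _ _).2 ?_).some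
    simpa using h₀.postcomp π
  obtain ⟨L, hL₀, hL₁⟩ := h₁
  obtain ⟨L', hL', hL'₀⟩ := hπ.exists_lift L (fun _ _ _ ↦ trivial) s₀ hL₀.symm
  refine ⟨inc 1 Y ≫ L', by rw [Category.assoc, hL', hL₁], ?_⟩
  exact .trans_of_left (hX 0) (.precomp ⟨L', hL'₀, rfl⟩ π) h₀

theorem hasLiftingProperty_of_isWeakHomotopyEquivalence {π : X ⟶ Y}
    (hX : ∀ k, PrismLifts k Set.univ (SSet.stdSimplex.isTerminalObj₀.from X))
    (hY : ∀ k, PrismLifts k Set.univ (SSet.stdSimplex.isTerminalObj₀.from Y))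
    (hπ : ∀ k, PrismLifts k Set.univ π) (h : IsWeakHomotopyEquivalence π) {M : SSet.{u}}
    (N : M.Subcomplex) : HasLiftingProperty N.ι π := by
  obtain ⟨s, hs, H, hH₀, hH₁⟩ := exists_section_of_isWeakHomotopyEquivalence hX hY (hπ 0) h
  refine ⟨fun {u v} sq ↦ ?_⟩
  -- The map `v ≫ s` lifts `v`, but agrees with `u` on `N` only up to `H`. Extending that homotopy
  -- to `M` corrects the restriction: the end `w` restricts to `u`, but lies over `v` only up to `K
  -- ≫ π`.
  obtain ⟨K, -, hK₀, hK⟩ := hX 0 M N (SSet.stdSimplex.isTerminalObj₀.from _) (fun _ _ _ ↦ trivial)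
    (v ≫ s) (Δ[1] ◁ u ≫ H) (SSet.stdSimplex.isTerminalObj₀.hom_ext _ _)
    (SSet.stdSimplex.isTerminalObj₀.hom_ext _ _)
    (by rw [inc_naturality_assoc, hH₀, reassoc_of% sq.w])
  obtain ⟨w, hw⟩ : ∃ w, w = inc 1 M ≫ K := ⟨_, rfl⟩
  have hwu : N.ι ≫ w = u := by
    rw [hw, ← inc_naturality_assoc, hK, inc_naturality_assoc, hH₁, Category.comp_id]
  -- On `N` the homotopies `K ≫ π` and `Δ[1] ◁ w ≫ H ≫ π` coincide. Filling the square between them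
  -- makes the end `0` of `G` a homotopy from `v` to `w ≫ π` that is constant on `N`.
  obtain ⟨G, -, -, hG, hG'⟩ := (hY 1).exists_double_lift N (SSet.stdSimplex.isTerminalObj₀.from _)
    (fun _ _ _ ↦ trivial) (snd _ _ ≫ w ≫ π) ![K ≫ π, Δ[1] ◁ w ≫ H ≫ π]
    (Δ[1] ◁ snd _ _ ≫ Δ[1] ◁ u ≫ H ≫ π)
    (SSet.stdSimplex.isTerminalObj₀.hom_ext _ _)
    (fun _ ↦ SSet.stdSimplex.isTerminalObj₀.hom_ext _ _)
    (SSet.stdSimplex.isTerminalObj₀.hom_ext _ _)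
    (Fin.forall_fin_two.2 ⟨by
      change inc 1 M ≫ K ≫ π = _
      rw [inc_snd_assoc, hw, Category.assoc], by
      change inc 1 M ≫ Δ[1] ◁ w ≫ H ≫ π = _
      rw [inc_snd_assoc, inc_naturality_assoc, reassoc_of% hH₁]⟩)
    (by
      rw [inc_naturality_assoc, inc_naturality_assoc, reassoc_of% hH₁, ← hwu, whiskerLeft_snd_assoc,
        Category.assoc])
    (Fin.forall_fin_two.2 ⟨by
      change _ = Δ[1] ◁ N.ι ≫ K ≫ π
      rw [reassoc_of% hK]
      rfl, by
      change _ = Δ[1] ◁ N.ι ≫ Δ[1] ◁ w ≫ H ≫ π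
      rw [← whiskerLeft_comp_assoc, ← whiskerLeft_comp_assoc, ← whiskerLeft_comp_assoc, hwu]
      rfl⟩)
  have hG₀ : Δ[1] ◁ inc 0 M ≫ G = K ≫ π := hG 0
  have hG₁ : Δ[1] ◁ inc 1 M ≫ G = Δ[1] ◁ w ≫ H ≫ π := hG 1
  -- Lifting this relative homotopy backwards from `w` ends at a map over `v` that still restricts
  -- to `u`.
  obtain ⟨F, hF, hF₁, hF'⟩ := hπ 1 M N (inc 0 _ ≫ G) (fun _ _ _ ↦ trivial) w (snd _ _ ≫ u)
    (by
      rw [← inc_naturality_assoc, hG₁, inc_naturality_assoc, reassoc_of% hH₀, hs, Category.comp_id])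
    (by
      rw [← inc_naturality_assoc, hG', inc_naturality_assoc, inc_naturality_assoc,
        reassoc_of% hH₀, hs, Category.comp_id, Category.assoc])
    (by rw [inc_snd_assoc, hwu])
  refine ⟨⟨inc 0 M ≫ F, ?_, ?_⟩⟩
  · rw [← inc_naturality_assoc, hF', inc_snd_assoc]
  · rw [Category.assoc, hF, ← inc_naturality_assoc, hG₀, reassoc_of% hK₀, hs, Category.comp_id]

end Weak

/-! ### Transporting lifting problems into fibers. -/

section Boundary

/-- The lifting problem is carried along `H` from the end `k` to the end `k'`, solved there, and the
solution is carried back relative to `N`. The way out needs all edges in `D`; the way back needs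
only those outside `N` in `D'`, since `U` already prescribes the lift on `N`. -/
theorem hasLift_of_transport {k k' : Fin 2} {P Y S M : SSet.{u}} {g : P ⟶ Y} {q : Y ⟶ S}
    {D D' : Set (S _⦋1⦌)} (hq : PrismLifts k D q) (hg : PrismLifts k (q.app _ ⁻¹' D) g)
    (hg' : PrismLifts k' (q.app _ ⁻¹' D') g) (N : M.Subcomplex) (H : Δ[1] ⊗ M ⟶ S)
    (hH : EndEdges k D ⊥ H) (hH' : EndEdges k' D' N H)
    (h : ∀ v : M ⟶ Y, v ≫ q = inc k' M ≫ H → HasLiftingPropertyFixedBot N.ι g v)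
    (v : M ⟶ Y) (hv : v ≫ q = inc k M ≫ H) : HasLiftingPropertyFixedBot N.ι g v := by
  intro u sq
  obtain ⟨V, hV, hV'⟩ := hq.exists_lift H hH v hv
  obtain ⟨U, hU, hU'⟩ := hg.exists_lift (Δ[1] ◁ N.ι ≫ V)
    (EndEdges.whiskerLeft (D := q.app _ ⁻¹' D) (N := ⊥)
      (fun n x hx ↦ by
        change (V ≫ q).app _ _ ∈ D
        rw [hV]
        exact hH n x hx) _ _ (fun _ _ _ h ↦ h)) u
    (by rw [inc_naturality_assoc, hV', sq.w])
  obtain ⟨⟨w, hw, hw'⟩⟩ := h (inc k' M ≫ V) (by rw [Category.assoc, hV]) (inc k' _ ≫ U)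
    ⟨by rw [Category.assoc, hU, inc_naturality_assoc]⟩
  obtain ⟨G, hG, -, hG'⟩ := hg' M N V
    (fun n x hx ↦ by
      change (V ≫ q).app _ _ ∈ D'
      rw [hV]
      exact hH' n x hx) w U hw' hU hw.symm
  refine ⟨⟨inc k M ≫ G, ?_, ?_⟩⟩
  · rw [← inc_naturality_assoc, hG', hU']
  · rw [Category.assoc, hG, hV']

end Boundary

section Contraction

/-- The contraction of `Δ[n]` to its first vertex (`k = 0`), resp. last vertex (`k = 1`), which is
attained at the end `k` of the cylinder. -/
def contraction (k : Fin 2) (n : ℕ) : (Δ[1] ⊗ Δ[n] : SSet.{u}) ⟶ Δ[n] :=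
  ofMonotone₂ (fun a j ↦ if a = k then endPt k n else j) (by
    intro a a' b b' h h'
    fin_cases k <;> fin_cases a <;> fin_cases a' <;> simp [endPt, Fin.le_last] at h ⊢ <;> grind)

lemma inc_contraction_of_ne {k l : Fin 2} (h : l ≠ k) (n : ℕ) :
    inc l _ ≫ contraction.{u} k n = 𝟙 _ := by
  ext ⟨⟨m⟩⟩ x j
  exact congrArg Fin.val ((inc_ofMonotone₂_app _ _ l x _).trans (if_neg h))

lemma inc_contraction_self (k : Fin 2) (n : ℕ) :
    inc k _ ≫ contraction.{u} k n = SSet.const (SSet.stdSimplex.obj₀Equiv.symm (endPt k n)) := by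
  ext ⟨⟨m⟩⟩ x j
  exact congrArg Fin.val ((inc_ofMonotone₂_app _ _ k x _).trans (if_pos rfl))

lemma apply_endPt_of_notMem_boundary (k : Fin 2) {n m : ℕ} {x : (Δ[n] : SSet.{u}) _⦋m⦌}
    (hx : x ∉ ∂Δ[n].obj _) : x (endPt k m) = endPt k n := by
  rw [SSet.mem_boundary_iff_notMem_range] at hx
  push Not at hx
  obtain ⟨i, hi⟩ := hx (endPt k n)
  have hmono := (SSet.stdSimplex.asOrderHom x).monotone
  fin_cases k
  · exact le_antisymm ((hmono (Fin.zero_le i)).trans hi.le) (Fin.zero_le _)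
  · exact le_antisymm (Fin.le_last _) (hi.ge.trans (hmono (Fin.le_last i)))

/-- A simplex outside the boundary hits every vertex, so its end vertex is the center of the
contraction, which stays fixed. For simplices of the boundary the edge may be nondegenerate, which
is why the condition is relative. -/
lemma endEdges_contraction (k : Fin 2) (n : ℕ) :
    EndEdges k ((Δ[n] : SSet.{u}).degenerate 1) ∂Δ[n] (contraction k n) := by
  intro m x hx
  have h : (contraction k n).app _ (edgeAt (endVertex k x)) =
      (Δ[n] : SSet.{u}).σ 0 (SSet.stdSimplex.obj₀Equiv.symm (endPt k n)) := by
    refine SSet.stdSimplex.ext _ _ (fun i ↦ ?_)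
    refine (ofMonotone₂_app _ _ _ _ i).trans ?_
    change (if _ then _ else x (endPt k m)) = endPt k n
    rw [apply_endPt_of_notMem_boundary k hx, ite_self]
  rw [h]
  exact SSet.σ_mem_degenerate _ _ _

end Contraction

lemma from_comp_yonedaEquiv_symm {X A : SSet.{u}} (a : A _⦋0⦌) :
    SSet.stdSimplex.isTerminalObj₀.from X ≫ SSet.yonedaEquiv.symm a = SSet.const a := by
  have h : SSet.yonedaEquiv.symm a = SSet.const a := by
    rw [Equiv.symm_apply_eq]
    change a = A.map (SimplexCategory.const ⦋0⦌ ⦋0⦌ 0).op a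
    rw [Subsingleton.elim (SimplexCategory.const ⦋0⦌ ⦋0⦌ 0) (𝟙 _)]
    simp
  rw [h, SSet.comp_const]

/-- Two transports reduce to simplices over a single vertex of `A × B`. Each leaves one coordinate
constant along the cylinder, which permits the way out, and contracts the other to the end whose
edges are then degenerate, which permits the way back. -/
theorem hasLiftingProperty_boundary {A B P Y : SSet.{u}} {p : P ⟶ A ⊗ B} {q : Y ⟶ A ⊗ B} {g : P ⟶ Y}
    (w : g ≫ q = p) (hq₀ : PrismLifts 0 {e | (snd A B).app _ e ∈ B.degenerate 1} q)
    (hq₁ : PrismLifts 1 {e | (fst A B).app _ e ∈ A.degenerate 1} q)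
    (hg₀ : PrismLifts 0 (q.app _ ⁻¹' {e | (snd A B).app _ e ∈ B.degenerate 1}) g)
    (hg₁ : PrismLifts 1 (q.app _ ⁻¹' {e | (fst A B).app _ e ∈ A.degenerate 1}) g)
    (hfib : ∀ (a : A _⦋0⦌) (b : B _⦋0⦌) (n : ℕ),
      HasLiftingProperty ∂Δ[n].ι (fiberMap g w (vertexPair a b))) (n : ℕ) :
    HasLiftingProperty ∂Δ[n].ι g := by
  suffices h : ∀ v : Δ[n] ⟶ Y, HasLiftingPropertyFixedBot ∂Δ[n].ι g v from
    ⟨fun sq ↦ h _ _ sq⟩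
  have hconst (a : A _⦋0⦌) (b : B _⦋0⦌) (v : Δ[n] ⟶ Y)
      (hv : v ≫ q = lift (SSet.const a) (SSet.const b)) :
      HasLiftingPropertyFixedBot ∂Δ[n].ι g v := by
    have := hfib a b n
    refine hasLift_of_fiberMap w (vertexPair a b) ∂Δ[n].ι v (hv.trans ?_)
    rw [vertexPair, comp_lift, from_comp_yonedaEquiv_symm, from_comp_yonedaEquiv_symm]
  have hA (a : A _⦋0⦌) (v : Δ[n] ⟶ Y) (hv : v ≫ q ≫ fst _ _ = SSet.const a) :
      HasLiftingPropertyFixedBot ∂Δ[n].ι g v := by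
    -- With the `A`-coordinate already constant, contract the `B`-coordinate to its first vertex,
    -- moving from the end `1` to the end `0`.
    refine hasLift_of_transport hq₁ hg₁ hg₀ ∂Δ[n]
      (lift (SSet.const a) (contraction 0 n ≫ v ≫ q ≫ snd _ _)) ?_ ?_ ?_ v ?_
    · exact fun m x hx ↦
        SSet.degenerate_app_apply (SSet.σ_mem_degenerate Δ[n] 0 (endVertex 1 x))
          (SSet.const a)
    · exact fun m x hx ↦
        SSet.degenerate_app_apply (endEdges_contraction 0 n m x hx) (v ≫ q ≫ snd _ _)
    · intro v' hv'
      refine hconst a ((v ≫ q ≫ snd _ _).app _ (SSet.stdSimplex.obj₀Equiv.symm (endPt 0 n))) v' ?_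
      rw [hv', comp_lift, ← Category.assoc (inc 0 _) (contraction 0 n), inc_contraction_self,
        SSet.const_comp, SSet.comp_const]
    · rw [comp_lift, ← Category.assoc (inc 1 _) (contraction 0 n),
        inc_contraction_of_ne (by decide), Category.id_comp, SSet.comp_const]
      apply CartesianMonoidalCategory.hom_ext
      · rw [Category.assoc, hv, lift_fst]
      · rw [Category.assoc, lift_snd]
  intro v
  -- Keep the `B`-coordinate and contract the `A`-coordinate to its last vertex, moving from the end
  -- `0` to the end `1`.
  refine hasLift_of_transport hq₀ hg₀ hg₁ ∂Δ[n]
    (lift (contraction 1 n ≫ v ≫ q ≫ fst _ _) (snd _ _ ≫ v ≫ q ≫ snd _ _)) ?_ ?_ ?_ v ?_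
  · exact fun m x hx ↦ SSet.degenerate_app_apply (SSet.σ_mem_degenerate Δ[n] 0 _) (v ≫ q ≫ snd _ _)
  · exact fun m x hx ↦
      SSet.degenerate_app_apply (endEdges_contraction 1 n m x hx) (v ≫ q ≫ fst _ _)
  · intro v' hv'
    refine hA ((v ≫ q ≫ fst _ _).app _ (SSet.stdSimplex.obj₀Equiv.symm (endPt 1 n))) v' ?_
    rw [← Category.assoc, hv', comp_lift, lift_fst, ← Category.assoc (inc 1 _) (contraction 1 n),
      inc_contraction_self, SSet.const_comp]
  · rw [comp_lift, ← Category.assoc (inc 0 _) (contraction 1 n),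
      inc_contraction_of_ne (by decide), Category.id_comp, inc_snd_assoc]
    apply CartesianMonoidalCategory.hom_ext
    · simp
    · simp

/-! ### Sections of trivial fibrations, and the retraction of the path space. -/

section TrivialFibration

lemma HomotopicOver.of_comp {X Y S T : SSet.{u}} {p : X ⟶ S} {q : Y ⟶ S} {f g : X ⟶ Y}
    (h : HomotopicOver p q f g) (t : S ⟶ T) : HomotopicOver (p ≫ t) (q ≫ t) f g := by
  obtain ⟨H, hH, h₀, h₁⟩ := h
  exact ⟨H, by rw [reassoc_of% hH], h₀, h₁⟩

theorem exists_section_homotopicOver {P Y : SSet.{u}} (g : P ⟶ Y)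
    (hg : ∀ n : ℕ, HasLiftingProperty ∂Δ[n].ι g) :
    ∃ s : Y ⟶ P, s ≫ g = 𝟙 Y ∧ HomotopicOver g g (g ≫ s) (𝟙 P) := by
  have hg' : (MorphismProperty.monomorphisms SSet.{u}).rlp g := by
    rw [SSet.rlp_monomorphisms]
    rintro _ _ _ ⟨n⟩
    exact hg n
  have lifts {M : SSet.{u}} (N : M.Subcomplex) : HasLiftingProperty N.ι g :=
    hg' _ (MorphismProperty.monomorphisms.infer_property _)
  obtain ⟨s, hs⟩ : ∃ s : Y ⟶ P, s ≫ g = 𝟙 Y := by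
    have := lifts (⊥ : Y.Subcomplex)
    have sq : CommSq (SSet.Subcomplex.isInitialBot.to P) (⊥ : Y.Subcomplex).ι g (𝟙 Y) :=
      ⟨SSet.Subcomplex.isInitialBot.hom_ext _ _⟩
    exact ⟨sq.lift, sq.fac_right⟩
  refine ⟨s, hs, ?_⟩
  let N := SSet.Subcomplex.unionProd ∂Δ[1] (⊥ : P.Subcomplex)
  have hN {n : SimplexCategoryᵒᵖ} (x : (Δ[1] ⊗ P).obj n) :
      x ∈ N.obj n ↔ ∃ k, (inc k P).app n x.2 = x := by
    refine (SSet.Subcomplex.mem_unionProd_iff _ _ x).trans ?_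
    rw [mem_boundary_one_iff]
    refine ⟨?_, fun ⟨k, hk⟩ ↦ Or.inr ⟨k, (congrArg Prod.fst hk).symm⟩⟩
    rintro (h | ⟨k, hk⟩)
    · exact h.elim
    · exact ⟨k, Prod.ext hk.symm rfl⟩
  obtain ⟨m, hm⟩ := exists_glue N (fun k ↦ inc k P)
    (fun n x hx ↦ ⟨_, _, ((hN x).1 hx).choose_spec⟩) ![g ≫ s, 𝟙 P] (by
      intro i j n t t' h
      obtain rfl : t = t' := congrArg Prod.snd h
      obtain rfl : i = j := const_one_injective (congrArg Prod.fst h)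
      rfl)
  have := lifts N
  have sq : CommSq m N.ι g (snd _ _ ≫ g) := ⟨by
    ext n ⟨x, hx⟩
    obtain ⟨k, hk⟩ := (hN x).1 hx
    obtain ⟨y, rfl⟩ : ∃ y, (inc k P).app n y = x := ⟨_, hk⟩
    refine (congrArg (g.app n) (hm k n y hx)).trans ?_
    fin_cases k
    · exact congr_app_apply (show (g ≫ s) ≫ g = g by rw [Category.assoc, hs, Category.comp_id]) n y
    · rfl⟩
  refine ⟨sq.lift, sq.fac_right, ?_, ?_⟩
  · ext n x
    exact (congr_app_apply sq.fac_left n ⟨_, (hN _).2 ⟨0, rfl⟩⟩).trans (hm 0 n x _)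
  · ext n x
    exact (congr_app_apply sq.fac_left n ⟨_, (hN _).2 ⟨1, rfl⟩⟩).trans (hm 1 n x _)

end TrivialFibration

namespace PathSpace

variable {X Y S : SSet.{u}} {p : X ⟶ S} {q : Y ⟶ S} {f : X ⟶ Y} (Z : PathSpace p q f)

/-- The source is a deformation retract over `S` of the mapping path space. -/
theorem exists_deformation (w : f ≫ q = p) :
    ∃ j : X ⟶ Z.P, j ≫ Z.r = 𝟙 X ∧ j ≫ Z.g = f ∧
      HomotopicOver (Z.r ≫ p) (Z.r ≫ p) (Z.r ≫ j) (𝟙 Z.P) := by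
  obtain ⟨j, hj, hj'⟩ := Z.exists_lift (𝟙 X) (snd _ _ ≫ f) rfl (by
    rw [Category.assoc, w, Category.id_comp])
  -- Precomposing a path with `min t` truncates it at time `t`: the constant path at `t = 0`, the
  -- whole path at `t = 1`.
  let μ : (Δ[1] ⊗ Δ[1] : SSet.{u}) ⟶ Δ[1] := ofMonotone₂ min (fun _ _ _ _ h h' ↦ min_le_min h h')
  let m (M : SSet.{u}) : Δ[1] ⊗ (Δ[1] ⊗ M) ⟶ Δ[1] ⊗ M :=
    lift (lift (fst _ _) (snd _ _ ≫ fst _ _) ≫ μ) (snd _ _ ≫ snd _ _)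
  have hm₀ (M : SSet.{u}) : inc 0 _ ≫ m M = snd _ _ ≫ inc 0 M := by
    apply CartesianMonoidalCategory.hom_ext
    · ext ⟨⟨n⟩⟩ ⟨a, x⟩ i
      exact congrArg Fin.val (Fin.zero_le _ |> min_eq_left : min 0 (a i) = 0)
    · rfl
  have hm₁ (M : SSet.{u}) : Δ[1] ◁ inc 0 M ≫ m M = snd _ _ ≫ inc 0 M := by
    apply CartesianMonoidalCategory.hom_ext
    · ext ⟨⟨n⟩⟩ ⟨a, x⟩ i
      exact congrArg Fin.val (Fin.zero_le _ |> min_eq_right : min (a i) 0 = 0)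
    · rfl
  have hm₂ (M : SSet.{u}) : Δ[1] ◁ inc 1 M ≫ m M = 𝟙 _ := by
    apply CartesianMonoidalCategory.hom_ext
    · ext ⟨⟨n⟩⟩ ⟨a, x⟩ i
      exact congrArg Fin.val (Fin.le_last _ |> min_eq_left : min (a i) 1 = a i)
    · rfl
  obtain ⟨Θ, hΘ, hΘ'⟩ := Z.exists_lift (snd _ _ ≫ Z.r) (m _ ≫ Z.ev)
    (by rw [reassoc_of% hm₀, Z.inc_ev, Category.assoc])
    (by
      rw [Category.assoc, Z.ev_comp]
      rfl)
  refine ⟨j, hj, ?_, Θ, by rw [reassoc_of% hΘ], Z.hom_ext ?_ ?_, Z.hom_ext ?_ ?_⟩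
  · rw [g, ← inc_naturality_assoc, hj', inc_snd_assoc]
  · rw [Category.assoc, hΘ, inc_snd_assoc, Category.assoc, hj, Category.comp_id]
  · rw [whiskerLeft_comp_assoc, hΘ', reassoc_of% hm₁, Z.inc_ev, whiskerLeft_comp_assoc, hj',
      whiskerLeft_snd_assoc]
  · rw [Category.assoc, hΘ, inc_snd_assoc, Category.id_comp]
  · rw [whiskerLeft_comp_assoc, hΘ', reassoc_of% hm₂, whiskerLeft_id, Category.id_comp]

end PathSpace

lemma mapπ₀_pre_id (X K : SSet.{u}) : SSet.mapπ₀ ((MonoidalClosed.pre (𝟙 X)).app K) = id := by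
  funext x
  rw [MonoidalClosed.pre_id]
  exact SSet.mapπ₀_id_apply x

theorem IsWeakHomotopyEquivalence.of_comp_left {X Y Z : SSet.{u}} {f : X ⟶ Y} {g : Y ⟶ Z}
    (hf : IsWeakHomotopyEquivalence f) (hfg : IsWeakHomotopyEquivalence (f ≫ g)) :
    IsWeakHomotopyEquivalence g := by
  intro K hK
  have h : SSet.mapπ₀ ((MonoidalClosed.pre (f ≫ g)).app K) =
      SSet.mapπ₀ ((MonoidalClosed.pre f).app K) ∘ SSet.mapπ₀ ((MonoidalClosed.pre g).app K) := by
    funext x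
    rw [MonoidalClosed.pre_map, NatTrans.comp_app, SSet.mapπ₀_comp_apply]
    rfl
  exact (Function.Bijective.of_comp_iff' (hf K hK) _).1 (h ▸ hfg K hK)

theorem PrismLifts.comp {k : Fin 2} {X Y S : SSet.{u}} {f : X ⟶ Y} {q : Y ⟶ S} {D : Set (S _⦋1⦌)}
    (hq : PrismLifts k D q) (hf : PrismLifts k (q.app _ ⁻¹' D) f) : PrismLifts k D (f ≫ q) := by
  intro M N H hH b e hb he hbe
  obtain ⟨G, rfl, hG, hG'⟩ := hq M N H hH (b ≫ f) (e ≫ f) (by rw [Category.assoc, hb])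
    (by rw [Category.assoc, he]) (by rw [reassoc_of% hbe])
  obtain ⟨G', rfl, h₁, h₂⟩ := hf M N G hH b e hG.symm hG'.symm hbe
  exact ⟨G', (Category.assoc _ _ _).symm, h₁, h₂⟩

/-- Equality in `π₀` of the mapping space is only a zigzag of homotopies over `S`. The induced
operator is unchanged along each edge, so it descends to `π₀`; no Kan condition is required. -/
lemma mapπ₀_pre_fiberMap_eq {X Y S : SSet.{u}} {p : X ⟶ S} {q : Y ⟶ S} {f g : X ⟶ Y}
    (hf : f ≫ q = p) (hg : g ≫ q = p) (h : SSet.π₀.mk (SSet.yonedaEquiv (mapOverVertex f hf)) =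
      SSet.π₀.mk (SSet.yonedaEquiv (mapOverVertex g hg))) (s : Δ[0] ⟶ S) (K : SSet.{u}) :
    SSet.mapπ₀ ((MonoidalClosed.pre (fiberMap f hf s)).app K) =
      SSet.mapπ₀ ((MonoidalClosed.pre (fiberMap g hg s)).app K) := by
  choose φ hφ hφ' using
    fun x : (mapOver p q) _⦋0⦌ ↦ mapOverVertex_surjective (SSet.yonedaEquiv.symm x)
  have hφ'' (f : X ⟶ Y) (hf : f ≫ q = p) : φ (SSet.yonedaEquiv (mapOverVertex f hf)) = f := by
    have := hφ' (SSet.yonedaEquiv (mapOverVertex f hf))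
    rw [Equiv.symm_apply_apply] at this
    refine fst_comp_injective ((mapOverUncurry_curry _ ?_).symm.trans
      ((congrArg mapOverUncurry this).symm.trans (mapOverUncurry_curry _ ?_)))
    · rw [Category.assoc, hφ]
    · rw [Category.assoc, hf]
  have key := congrArg (SSet.π₀.lift
    (fun x ↦ SSet.mapπ₀ ((MonoidalClosed.pre (fiberMap (φ x) (hφ x) s)).app K))
    (fun x y e ↦ mapπ₀_pre_eq_of_homotopic (HomotopicOver.fiberMap
      ((exists_edge_mapOverVertex_iff _ _ (hφ x) (hφ y)).1 (by
        rw [← hφ', ← hφ', ← π₀Rel_iff, Equiv.apply_symm_apply, Equiv.apply_symm_apply]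
        exact ⟨e⟩)) _ _ s) K)) h
  rw [SSet.π₀.lift_mk, SSet.π₀.lift_mk] at key
  simpa only [hφ''] using key

/-! ### The two implications. -/

section Main

variable {A B X Y : SSet.{u}} {p : X ⟶ A ⊗ B} {q : Y ⟶ A ⊗ B} {f : X ⟶ Y}

lemma degenerate_subset_snd :
    (A ⊗ B).degenerate 1 ⊆ {e | (snd A B).app _ e ∈ B.degenerate 1} :=
  fun _ he ↦ SSet.degenerate_app_apply he (snd A B)

lemma degenerate_subset_fst :
    (A ⊗ B).degenerate 1 ⊆ {e | (fst A B).app _ e ∈ A.degenerate 1} :=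
  fun _ he ↦ SSet.degenerate_app_apply he (fst A B)

theorem IsBifibration.kanComplex_mapOver (hp : IsBifibration p) (q : Y ⟶ A ⊗ B) :
    SSet.KanComplex (mapOver q p) :=
  kanComplex_of_prismLifts (prismLifts_mapOver degenerate_subset_snd hp.prismLifts_zero)
    (prismLifts_mapOver degenerate_subset_fst hp.prismLifts_one)

theorem exists_homotopyInverse_of_isPointwiseWeakHomotopyEquivalence (hp : IsBifibration p)
    (hq : IsBifibration q) (w : f ≫ q = p) (h : IsPointwiseWeakHomotopyEquivalence f w) :
    ∃ f' : Y ⟶ X, f' ≫ p = q ∧ HomotopicOver p p (f ≫ f') (𝟙 X) ∧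
      HomotopicOver q q (f' ≫ f) (𝟙 Y) := by
  let Z := pathSpace p q f
  obtain ⟨j, hj, hjg, hrj⟩ := Z.exists_deformation w
  have hj' : j ≫ Z.r ≫ p = p := by rw [reassoc_of% hj]
  have hg₀ := Z.prismLifts_g w hp.prismLifts_zero hq.prismLifts_zero
  have hg₁ := Z.prismLifts_g w hp.prismLifts_one hq.prismLifts_one
  have hY (s : Δ[0] ⟶ A ⊗ B) (k : Fin 2) :
      PrismLifts k Set.univ (SSet.stdSimplex.isTerminalObj₀.from (fiber q s)) := by
    fin_cases k
    · exact hq.prismLifts_zero.from_fiber degenerate_subset_snd s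
    · exact hq.prismLifts_one.from_fiber degenerate_subset_fst s
  have hg (s : Δ[0] ⟶ A ⊗ B) (k : Fin 2) : PrismLifts k Set.univ (fiberMap Z.g Z.g_comp s) := by
    fin_cases k
    · exact hg₀.fiberMap_univ degenerate_subset_snd Z.g_comp s
    · exact hg₁.fiberMap_univ degenerate_subset_fst Z.g_comp s
  have hP (s : Δ[0] ⟶ A ⊗ B) (k : Fin 2) :
      PrismLifts k Set.univ (SSet.stdSimplex.isTerminalObj₀.from (fiber (Z.r ≫ p) s)) := by
    rw [SSet.stdSimplex.isTerminalObj₀.hom_ext (SSet.stdSimplex.isTerminalObj₀.from _)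
      (fiberMap Z.g Z.g_comp s ≫ SSet.stdSimplex.isTerminalObj₀.from _)]
    exact (hY s k).comp (hg s k)
  have hjs (s : Δ[0] ⟶ A ⊗ B) : IsWeakHomotopyEquivalence (fiberMap j hj' s) := by
    refine isWeakHomotopyEquivalence_of_inverse _ (fiberMap Z.r rfl s) (fun K ↦ ?_) (fun K ↦ ?_)
    · have : fiberMap j hj' s ≫ fiberMap Z.r rfl s = 𝟙 _ := by
        rw [fiberMap_comp, ← fiberMap_id (p := p)]
        congr
      rw [this, mapπ₀_pre_id]
    · rw [fiberMap_comp, mapπ₀_pre_eq_of_homotopic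
        (hrj.fiberMap (by rw [Category.assoc, hj']) (Category.id_comp _) s), fiberMap_id,
        mapπ₀_pre_id]
  -- Two out of three on fibers, since `j ≫ Z.g = f`.
  have hgs (a : A _⦋0⦌) (b : B _⦋0⦌) :
      IsWeakHomotopyEquivalence (fiberMap Z.g Z.g_comp (vertexPair a b)) := by
    refine (hjs (vertexPair a b)).of_comp_left ?_
    rw [fiberMap_comp]
    convert h a b
  obtain ⟨s, hs, hL⟩ := exists_section_homotopicOver Z.g
    (hasLiftingProperty_boundary Z.g_comp hq.prismLifts_zero hq.prismLifts_one hg₀ hg₁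
      (fun a b n ↦ hasLiftingProperty_of_isWeakHomotopyEquivalence (hP _) (hY _) (hg _) (hgs a b) _))
  -- With `f' = s ≫ Z.r`, the composite `f ≫ f' = j ≫ Z.g ≫ s ≫ Z.r` deforms to `j ≫ Z.r = 𝟙 X`, and
  -- the path evaluation deforms `f' ≫ f` to `s ≫ Z.g = 𝟙 Y`.
  refine ⟨s ≫ Z.r, by rw [Category.assoc, ← Z.g_comp, reassoc_of% hs], ?_, ?_⟩
  · have := ((hL.precomp j rfl).of_comp q).postcomp (r := p) Z.r Z.g_comp.symm
    rw [hjg, w, Category.comp_id, hj, reassoc_of% hjg] at this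
    exact this
  · have h₁ : HomotopicOver (Z.r ≫ p) q (Z.r ≫ f) Z.g := ⟨Z.ev, Z.ev_comp, Z.inc_ev, rfl⟩
    have := h₁.precomp (r := q) s (by rw [← Z.g_comp, reassoc_of% hs])
    rwa [hs, ← Category.assoc] at this

theorem IsBivariantEquivalence.isPointwiseWeakHomotopyEquivalence (hp : IsBifibration p)
    (hq : IsBifibration q) (w : f ≫ q = p) (h : IsBivariantEquivalence f w) :
    IsPointwiseWeakHomotopyEquivalence f w := by
  obtain ⟨-, -, G, ⟨h₁⟩, ⟨h₂⟩⟩ := h X p hp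
  -- The candidate inverse is the image of `𝟙 X` under the homotopy inverse of precomposition with
  -- `f`.
  obtain ⟨g, hg, hgx⟩ := mapOverVertex_surjective (mapOverVertex (𝟙 X) (Category.id_comp p) ≫ G)
  have hfg : HomotopicOver p p (f ≫ g) (𝟙 X) := by
    obtain ⟨e, he₁, he₂⟩ := exists_edge_of_homotopy h₂
      (mapOverVertex (𝟙 X) (Category.id_comp p))
    refine (exists_edge_mapOverVertex_iff _ _ (by rw [Category.assoc, hg, w])
      (Category.id_comp p)).1 ⟨e, ?_, ?_⟩
    · rw [he₁, ← Category.assoc, hgx, mapOverVertex_pre]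
    · rw [he₂, Category.comp_id]
  obtain ⟨-, -, G', ⟨h₁'⟩, -⟩ := h Y q hq
  have hgf : g ≫ f ≫ q = q := by rw [w, hg]
  -- Precomposition with `f` is injective on `π₀` of `mapOver q q`, with left inverse induced by
  -- `G'`, and it sends `g ≫ f` and `𝟙 Y` to the homotopic maps `f ≫ g ≫ f` and `f`.
  have hπ : SSet.π₀.mk (SSet.yonedaEquiv (mapOverVertex (q := q) (g ≫ f) (by simpa using hgf))) =
      SSet.π₀.mk (SSet.yonedaEquiv (mapOverVertex (q := q) (𝟙 Y) (Category.id_comp q))) := by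
    have edge {Q : SSet.{u}} {x y : Δ[0] ⟶ Q} (h : ∃ e : Δ[1] ⟶ Q, SSet.stdSimplex.δ 1 ≫ e = x ∧
        SSet.stdSimplex.δ 0 ≫ e = y) :
        SSet.π₀.mk (SSet.yonedaEquiv x) = SSet.π₀.mk (SSet.yonedaEquiv y) :=
      SSet.π₀.sound ((π₀Rel_iff _ _).2 h).some
    have e₁ := edge (exists_edge_of_homotopy h₁'
      (mapOverVertex (q := q) (g ≫ f) (by simpa using hgf)))
    have e₂ := edge (exists_edge_of_homotopy h₁'
      (mapOverVertex (q := q) (𝟙 Y) (Category.id_comp q)))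
    have h₃ : HomotopicOver p q (f ≫ g ≫ f) (f ≫ 𝟙 Y) := by simpa using hfg.postcomp f w
    have e₃ := congrArg (SSet.mapπ₀ G') (edge ((exists_edge_mapOverVertex_iff (f ≫ g ≫ f) (f ≫ 𝟙 Y)
      (by rw [Category.assoc, Category.assoc, hgf, w]) (by rw [Category.comp_id, w])).2 h₃))
    rw [SSet.mapπ₀_mk, SSet.mapπ₀_mk, ← SSet.yonedaEquiv_comp, ← SSet.yonedaEquiv_comp] at e₃
    rw [← Category.assoc, mapOverVertex_pre, Category.comp_id (mapOverVertex _ _)] at e₁ e₂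
    exact e₁.symm.trans (e₃.trans e₂)
  intro a b
  refine isWeakHomotopyEquivalence_of_inverse _ (fiberMap g hg (vertexPair a b))
    (fun K ↦ ?_) (fun K ↦ ?_)
  · rw [fiberMap_comp, mapπ₀_pre_eq_of_homotopic
      (hfg.fiberMap (by rw [Category.assoc, hg, w]) (Category.id_comp p) _), fiberMap_id,
      mapπ₀_pre_id]
  · rw [fiberMap_comp, mapπ₀_pre_fiberMap_eq _ _ hπ, fiberMap_id, mapπ₀_pre_id]

end Main

end Bivariant

end

theorem mainTheorem6 {A B X Y : SSet.{u}} (p : X ⟶ A ⊗ B) (q : Y ⟶ A ⊗ B)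
    (hp : Bivariant.IsBifibration p) (hq : Bivariant.IsBifibration q)
    (f : X ⟶ Y) (w : f ≫ q = p) :
    Bivariant.IsBivariantEquivalence f w ↔ Bivariant.IsPointwiseWeakHomotopyEquivalence f w := by
  refine ⟨fun h ↦ h.isPointwiseWeakHomotopyEquivalence hp hq w, fun h W r hr ↦ ?_⟩
  obtain ⟨f', hf', h₁, h₂⟩ :=
    Bivariant.exists_homotopyInverse_of_isPointwiseWeakHomotopyEquivalence hp hq w h
  exact ⟨hr.kanComplex_mapOver q, hr.kanComplex_mapOver p,
    Bivariant.isHomotopyEquivalence_mapOverPre w f' hf' h₁ h₂ r⟩
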